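/- Let $G=(V,E)$ be an infinite (simple) graph. Two rays of $G$ are equivalent if, for every finite $S\subseteq V$, both have a tail in the same component of $G-S$; the ends of $G$ are the equivalence classes of rays. A separation of $G$ is a pair $(A,B)$ of sets with $A\cup B=V$ such that $G$ has no edge between $A\setminus B$ and $B\setminus A$; its order is $|A\cap B|$. Let $\vec S$ be the set of all separations of finite order, with the topology whose basic open sets are the sets $\{(A,B)\in\vec S : A\cap Z=A_Z,\ B\cap Z=B_Z\}$ for finite $Z\subseteq V$ and separations $(A_Z,B_Z)$ of $G[Z]$. For $k\in\mathbb N$ let $\vec S_k$ be the set of separations of order less than $k$. Let $\omega$ be an end of $G$, let $\tau=\{(A,B)\in\vec S : \text{every ray of }\omega\text{ has a tail in }B\}$ be its end tangle, and let $k\in\mathbb N$. Let $\deg(\omega)\in\mathbb N\cup\{\infty\}$ be the largest size of a family of pairwise disjoint rays of $\omega$, and let $\operatorname{dom}(\omega)\in\mathbb N\cup\{\infty\}$ be the number of vertices $v$ that dominate $\omega$, i.e. for which there are a ray $R$ of $\omega$ and infinitely many paths from $v$ to vertices of $R$ that are pairwise disjoint except at $v$. Call $X\subseteq V$ a relative decider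 for $\tau\cap\vec S_k$ if $|A\cap X|<|B\cap X|$ for every $(A,B)\in\tau\cap\vec S_k$. Then the following are equivalent: (i) $\tau\cap\vec S_k$ is closed in $\vec S$; (ii) $\deg(\omega)+\operatorname{dom}(\omega)\ge k$; (iii) $\tau\cap\vec S_k$ has a finite relative decider; (iv) $\tau\cap\vec S_k$ has a relative decider of size exactly $k$. -/

import Mathlib

namespace EndTangle

variable {V : Type*}

/-! ### Rays and ends -/

/-- A ray of `G`: a one-way infinite path, listed from its start vertex. -/
structure Ray (G : SimpleGraph V) where
  vertex : ℕ → V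
  injective : Function.Injective vertex
  adj : ∀ n, G.Adj (vertex n) (vertex (n + 1))

/-- The vertex set of a ray. -/
def Ray.verts {G : SimpleGraph V} (R : Ray G) : Set V := Set.range R.vertex

/-- The ray `R` has a tail in the vertex set `B`. -/
def Ray.HasTailIn {G : SimpleGraph V} (R : Ray G) (B : Set V) : Prop :=
  ∃ n, ∀ m, n ≤ m → R.vertex m ∈ B

/-- Two rays are equivalent if, for every finite vertex set `S`, both have a tail in the same
component of `G - S`. -/
def Ray.Equivalent {G : SimpleGraph V} (R R' : Ray G) : Prop :=
  ∀ S : Set V, S.Finite →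
    ∃ C : G.ComponentCompl S, R.HasTailIn (C : Set V) ∧ R'.HasTailIn (C : Set V)

theorem Ray.exists_component {G : SimpleGraph V} (R : Ray G) {S : Set V} (hS : S.Finite) :
    ∃ C : G.ComponentCompl S, R.HasTailIn (C : Set V) := by
  have hfin : (R.vertex ⁻¹' S).Finite := hS.preimage R.injective.injOn
  obtain ⟨N, hN⟩ := hfin.bddAbove
  have hout : ∀ m, N + 1 ≤ m → R.vertex m ∉ S := by
    intro m hm hmem
    have := hN (show m ∈ R.vertex ⁻¹' S from hmem)
    omega
  refine ⟨G.componentComplMk (hout (N + 1) le_rfl), N + 1, ?_⟩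
  intro m hm
  induction m, hm using Nat.le_induction with
  | base => exact ⟨hout _ le_rfl, rfl⟩
  | succ m hm ih =>
    obtain ⟨h, hC⟩ := ih
    refine ⟨hout (m + 1) (by omega), ?_⟩
    rw [← hC]
    exact SimpleGraph.ConnectedComponent.sound
      (SimpleGraph.Adj.reachable (show (G.induce Sᶜ).Adj ⟨_, _⟩ ⟨_, _⟩ from (R.adj m).symm))

theorem Ray.component_unique {G : SimpleGraph V} (R : Ray G) {S : Set V}
    {C D : G.ComponentCompl S} (hC : R.HasTailIn (C : Set V)) (hD : R.HasTailIn (D : Set V)) :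
    C = D := by
  obtain ⟨n, hn⟩ := hC
  obtain ⟨m, hm⟩ := hD
  obtain ⟨_, h₁⟩ := hn (max n m) (le_max_left _ _)
  obtain ⟨_, h₂⟩ := hm (max n m) (le_max_right _ _)
  exact h₁.symm.trans h₂

/-- Equivalence of rays, as a setoid. -/
def raySetoid (G : SimpleGraph V) : Setoid (Ray G) where
  r := Ray.Equivalent
  iseqv :=
    { refl := fun R _ hS => (R.exists_component hS).imp fun _ h => ⟨h, h⟩
      symm := fun h S hS => (h S hS).imp fun _ hC => hC.symm
      trans := by
        intro R₁ R₂ R₃ h h' S hS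
        obtain ⟨C, hC₁, hC₂⟩ := h S hS
        obtain ⟨D, hD₂, hD₃⟩ := h' S hS
        obtain rfl := R₂.component_unique hC₂ hD₂
        exact ⟨C, hC₁, hD₃⟩ }

/-- An end of `G` is an equivalence class of rays. -/
def GraphEnd (G : SimpleGraph V) : Type _ := Quotient (raySetoid G)

/-- The set of `ω`-rays, i.e. the rays that belong to the end `ω`. -/
def GraphEnd.rays {G : SimpleGraph V} (ω : GraphEnd G) : Set (Ray G) :=
  {R | Quotient.mk (raySetoid G) R = ω}

/-- The (vertex) degree of an end: the largest size of a set of pairwise disjoint `ω`-rays. -/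
noncomputable def GraphEnd.degree {G : SimpleGraph V} (ω : GraphEnd G) : ℕ∞ :=
  ⨆ F ∈ {F : Set (Ray G) | F ⊆ ω.rays ∧ F.Pairwise fun R R' => Disjoint R.verts R'.verts},
    F.encard

/-- The vertex `v` sends infinitely many paths to the ray `R` that are pairwise disjoint except
at their common start vertex `v`. The paths are collected in an infinite set (not a family), so
the trivial path counts at most once if `v` lies on `R`. -/
def DominatesRay {G : SimpleGraph V} (v : V) (R : Ray G) : Prop :=
  ∃ F : Set (Σ w : V, G.Path v w), F.Infinite ∧ (∀ P ∈ F, P.1 ∈ R.verts) ∧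
    F.Pairwise fun P Q => ∀ u, u ∈ P.2.1.support → u ∈ Q.2.1.support → u = v

/-- The vertex `v` dominates the end `ω`. -/
def GraphEnd.IsDominatedBy {G : SimpleGraph V} (ω : GraphEnd G) (v : V) : Prop :=
  ∃ R ∈ ω.rays, DominatesRay v R

/-- The number of vertices that dominate `ω`. -/
noncomputable def GraphEnd.dom {G : SimpleGraph V} (ω : GraphEnd G) : ℕ∞ :=
  {v : V | ω.IsDominatedBy v}.encard

/-! ### Separations and their topology -/

/-- An oriented separation `(A, B)` of `G`. -/
@[ext]
structure Separation (G : SimpleGraph V) where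
  A : Set V
  B : Set V
  union_eq : A ∪ B = Set.univ
  not_adj : ∀ a ∈ A \ B, ∀ b ∈ B \ A, ¬ G.Adj a b

/-- The separation `(A ∩ Z, B ∩ Z)` of `G[Z]` induced by `(A, B)` on `Z`. -/
def Separation.restrict {G : SimpleGraph V} (s : Separation G) (Z : Set V) :
    Separation (G.induce Z) where
  A := {z | (z : V) ∈ s.A}
  B := {z | (z : V) ∈ s.B}
  union_eq := by
    ext z
    have h : (z : V) ∈ s.A ∪ s.B := s.union_eq ▸ Set.mem_univ _
    simpa using h
  not_adj := fun a ha b hb h => s.not_adj a ha b hb h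

/-- The order `|A ∩ B|` of a separation. -/
noncomputable def Separation.order {G : SimpleGraph V} (s : Separation G) : ℕ∞ :=
  (s.A ∩ s.B).encard

/-- The set of all oriented separations of `G` of finite order. -/
def FinSep (G : SimpleGraph V) : Type _ := {s : Separation G // (s.A ∩ s.B).Finite}

/-- The basic open set of all separations of finite order that induce the separation `t` of
`G[Z]` on `Z`. -/
def basicOpen {G : SimpleGraph V} {Z : Set V} (t : Separation (G.induce Z)) : Set (FinSep G) :=
  {s | s.1.restrict Z = t}

/-- The topology on the separations of finite order given by the basic open sets for finite `Z`. -/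
instance finSepTopology (G : SimpleGraph V) : TopologicalSpace (FinSep G) :=
  TopologicalSpace.generateFrom
    {O | ∃ Z : Set V, Z.Finite ∧ ∃ t : Separation (G.induce Z), O = basicOpen t}

/-- The set of all oriented separations of `G` of order less than `k`. -/
def sepsBelow (G : SimpleGraph V) (k : ℕ) : Set (FinSep G) := {s | s.1.order < k}

/-! ### End tangles and relative deciders -/

/-- The end tangle induced by `ω`: all separations `(A, B)` of finite order such that every ray of
`ω` has a tail in `B`. -/
def GraphEnd.tangle {G : SimpleGraph V} (ω : GraphEnd G) : Set (FinSep G) :=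
  {s | ∀ R ∈ ω.rays, R.HasTailIn s.1.B}

/-- `X` is a relative decider for `τ`: a strict majority of `X` lies in `B`, in the sense that
`|A ∩ X| < |B ∩ X|` as cardinals, for every `(A, B) ∈ τ`. -/
def IsRelativeDecider {G : SimpleGraph V} (X : Set V) (τ : Set (FinSep G)) : Prop :=
  ∀ s ∈ τ, Cardinal.mk ↥(s.1.A ∩ X) < Cardinal.mk ↥(s.1.B ∩ X)

end EndTangle

namespace EndTangle

variable {V : Type*} {G : SimpleGraph V}

/-! The implications proved are (i) → (ii) → (iv) → (iii) → (i).

(ii) → (iv): choose `m` disjoint `ω`-rays and a set `D` of dominating vertices with `m + |D| = k`.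
Dominating vertices lie in `B` for every `(A, B)` in the tangle, so each vertex of `D ∩ A` uses up a
separator vertex. To `D` add `m` guarded vertices, each placed on an `ω`-ray between two disjoint
finite hubs, where a hub is joined to all the chosen rays and to neighbours of all of `D`. If a
guarded vertex is outside `B`, both hubs meet `A ∩ B`: a hub missing it would lie on the `A`-side,
and then every chosen ray and every vertex of `D` would contribute to `A ∩ B`, giving order at least
`k`. So losing a guarded vertex costs two separator vertices, fewer than `k` are available, and `B`
keeps the majority (`exists_guarded_vertex`, `exists_isRelativeDecider`).

(iii) → (i): the trace on a finite decider determines which orientation of a separation of order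
less than `k` lies in the tangle, so non-membership is an open condition.

(i) → (ii): if `deg ω + dom ω < k`, the set `D` of all dominating vertices is finite, and `(V, D)`,
which is not in the tangle, is a limit of `τ ∩ S_k`. For this, every finite set outside `D` must be
cut off from `ω` by a separation of order less than `k` (`exists_mem_sepsBelow_separating`). If that
fails, take a nested sequence of tight separations running towards `ω`. Menger's theorem links
consecutive separators outside `D`, and the linkings concatenate to at least `k - dom ω` disjoint
`ω`-rays, a contradiction. -/

/-! ### Walks inside a vertex set -/

/-- `x` and `y` are joined by a walk of `G` all of whose edges lie in `U`. -/
def Joined (G : SimpleGraph V) (U : Set V) : V → V → Prop :=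
  Relation.ReflTransGen fun x y => x ∈ U ∧ y ∈ U ∧ G.Adj x y

theorem Joined.mono {U W : Set V} (h : U ⊆ W) {x y : V} (hxy : Joined G U x y) :
    Joined G W x y :=
  Relation.ReflTransGen.mono (fun _ _ h' => ⟨h h'.1, h h'.2.1, h'.2.2⟩) _ _ hxy

theorem Joined.symm {U : Set V} {x y : V} (hxy : Joined G U x y) : Joined G U y x := by
  induction hxy with
  | refl => exact Relation.ReflTransGen.refl
  | tail _ h ih => exact Relation.ReflTransGen.head ⟨h.2.1, h.1, h.2.2.symm⟩ ih

theorem Joined.trans {U : Set V} {x y z : V} (hxy : Joined G U x y) (hyz : Joined G U y z) :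
    Joined G U x z :=
  Relation.ReflTransGen.trans hxy hyz

theorem Joined.induct {U P : Set V} {x y : V} (hxy : Joined G U x y) (hx : x ∈ P)
    (h : ∀ u ∈ P, ∀ v, u ∈ U → v ∈ U → G.Adj u v → v ∈ P) : y ∈ P := by
  induction hxy with
  | refl => exact hx
  | tail _ h' ih => exact h _ ih _ h'.1 h'.2.1 h'.2.2

theorem Joined.mem {U : Set V} {x y : V} (hxy : Joined G U x y) (hx : x ∈ U) : y ∈ U :=
  hxy.induct hx fun _ _ _ _ h _ => h

theorem Joined.of_walk {U : Set V} {x y : V} (p : G.Walk x y) (hp : ∀ u ∈ p.support, u ∈ U) :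
    Joined G U x y := by
  induction p with
  | nil => exact Relation.ReflTransGen.refl
  | cons h p ih =>
    simp only [SimpleGraph.Walk.support_cons, List.mem_cons, forall_eq_or_imp] at hp
    exact Relation.ReflTransGen.head ⟨hp.1, hp.2 _ p.start_mem_support, h⟩ (ih hp.2)

theorem Joined.exists_walk {U : Set V} {x y : V} (hxy : Joined G U x y) (hx : x ∈ U) :
    ∃ p : G.Walk x y, ∀ u ∈ p.support, u ∈ U := by
  induction hxy with
  | refl => exact ⟨SimpleGraph.Walk.nil, by simpa using hx⟩
  | tail _ h' ih =>
    obtain ⟨p, hp⟩ := ih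
    refine ⟨p.concat h'.2.2, fun u hu => ?_⟩
    rw [SimpleGraph.Walk.support_concat] at hu
    rw [List.mem_append, List.mem_singleton] at hu
    rcases hu with hu | rfl
    · exact hp u hu
    · exact h'.2.1

theorem Joined.exists_path {U : Set V} {x y : V} (hxy : Joined G U x y) (hx : x ∈ U) :
    ∃ p : G.Path x y, ∀ u ∈ p.1.support, u ∈ U := by
  classical
  obtain ⟨p, hp⟩ := hxy.exists_walk hx
  exact ⟨p.toPath, fun u hu => hp u (p.support_toPath_subset_support hu)⟩

theorem Joined.exists_finset {U : Set V} {x y : V} (hxy : Joined G U x y) (hx : x ∈ U) :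
    ∃ W : Finset V, ↑W ⊆ U ∧ x ∈ W ∧ y ∈ W ∧ Joined G ↑W x y := by
  classical
  obtain ⟨p, hp⟩ := hxy.exists_walk hx
  exact ⟨p.support.toFinset, fun u hu => hp u (by simpa using hu), by simp, by simp,
    Joined.of_walk p fun u hu => by simpa using hu⟩

/-! ### Rays and separations -/

/-- The separation `(B, A)`. -/
def Separation.swap (s : Separation G) : Separation G where
  A := s.B
  B := s.A
  union_eq := by rw [Set.union_comm, s.union_eq]
  not_adj := fun a ha b hb h => s.not_adj b hb a ha h.symm

theorem Separation.mem_or (s : Separation G) (v : V) : v ∈ s.A ∨ v ∈ s.B :=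
  (s.union_eq ▸ Set.mem_univ v : v ∈ s.A ∪ s.B)

theorem Separation.mem_A_of_adj (s : Separation G) {u v : V} (hu : u ∉ s.B) (h : G.Adj u v) :
    v ∈ s.A := by
  by_contra hv
  exact s.not_adj u ⟨(s.mem_or u).resolve_right hu, hu⟩ v ⟨(s.mem_or v).resolve_left hv, hv⟩ h

/-- A step from outside `B` lands in `A`, and avoiding the separator keeps it outside `B`. Applied
to `s.swap`, this confines walks to `B \ A` instead. -/
theorem Separation.notMem_B_of_joined (s : Separation G) {U : Set V} {x y : V}
    (hU : ∀ u ∈ U, u ∈ s.A → u ∉ s.B) (hxy : Joined G U x y) (hx : x ∉ s.B) : y ∉ s.B :=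
  hxy.induct (P := s.Bᶜ) hx fun _ hu _ _ hv h => hU _ hv (s.mem_A_of_adj hu h)

theorem Ray.HasTailIn.mono {R : Ray G} {U W : Set V} (h : R.HasTailIn U) (hUW : U ⊆ W) :
    R.HasTailIn W :=
  h.imp fun _ hn m hm => hUW (hn m hm)

theorem Ray.HasTailIn.inter {R : Ray G} {U W : Set V} (h : R.HasTailIn U) (h' : R.HasTailIn W) :
    R.HasTailIn (U ∩ W) := by
  obtain ⟨n, hn⟩ := h
  obtain ⟨m, hm⟩ := h'
  exact ⟨max n m, fun i hi => ⟨hn i (le_of_max_le_left hi), hm i (le_of_max_le_right hi)⟩⟩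

theorem Ray.hasTailIn_compl (R : Ray G) {S : Set V} (hS : S.Finite) : R.HasTailIn Sᶜ := by
  obtain ⟨N, hN⟩ := (hS.preimage R.injective.injOn).bddAbove
  refine ⟨N + 1, fun m hm hmem => ?_⟩
  have := hN (show m ∈ R.vertex ⁻¹' S from hmem)
  omega

theorem Ray.joined (R : Ray G) {U : Set V} {n m : ℕ} (hnm : n ≤ m)
    (h : ∀ i, n ≤ i → i ≤ m → R.vertex i ∈ U) : Joined G U (R.vertex n) (R.vertex m) := by
  induction m, hnm using Nat.le_induction with
  | base => exact Relation.ReflTransGen.refl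
  | succ m hm ih =>
    exact (ih fun i hi hi' => h i hi (by omega)).tail
      ⟨h m hm (by omega), h _ (by omega) le_rfl, R.adj m⟩

theorem GraphEnd.exists_ray (ω : GraphEnd G) : ∃ R, R ∈ ω.rays :=
  Quotient.exists_rep ω

theorem GraphEnd.equivalent {ω : GraphEnd G} {R R' : Ray G} (h : R ∈ ω.rays) (h' : R' ∈ ω.rays) :
    R.Equivalent R' :=
  Quotient.exact (s := raySetoid G) (h.trans h'.symm)

theorem GraphEnd.mem_rays_of_equivalent {ω : GraphEnd G} {R R' : Ray G} (h : R ∈ ω.rays)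
    (h' : R'.Equivalent R) : R' ∈ ω.rays :=
  (Quotient.sound (s := raySetoid G) h').trans h

theorem joined_componentCompl {S : Set V} (C : G.ComponentCompl S) {x y : V}
    (hx : x ∈ (C : Set V)) (hy : y ∈ (C : Set V)) : Joined G (C : Set V) x y := by
  obtain ⟨hxS, hxC⟩ := hx
  obtain ⟨hyS, hyC⟩ := hy
  obtain ⟨p⟩ := SimpleGraph.ConnectedComponent.exact (hxC.trans hyC.symm)
  have key : ∀ {a b : ↑Sᶜ} (p : (G.induce Sᶜ).Walk a b),
      (G.induce Sᶜ).connectedComponentMk a = C → Joined G (C : Set V) a b := by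
    intro a b p
    induction p with
    | nil => exact fun _ => Relation.ReflTransGen.refl
    | @cons u v w h p ih =>
      intro hu
      have hv : (G.induce Sᶜ).connectedComponentMk v = C := by
        rw [← hu]
        exact SimpleGraph.ConnectedComponent.sound h.symm.reachable
      exact Relation.ReflTransGen.head ⟨⟨u.2, hu⟩, ⟨v.2, hv⟩, h⟩ (ih hv)
  exact key p hxC

/-- The component of `G - S` in which the end `ω` lives. -/
theorem GraphEnd.exists_component (ω : GraphEnd G) {S : Set V} (hS : S.Finite) :
    ∃ M : Set V, Disjoint M S ∧ (∀ R ∈ ω.rays, R.HasTailIn M) ∧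
      (∀ x ∈ M, ∀ y ∈ M, Joined G M x y) ∧ ∀ x ∈ M, ∀ y, G.Adj x y → y ∉ S → y ∈ M := by
  obtain ⟨R, hR⟩ := ω.exists_ray
  obtain ⟨C, hC⟩ := R.exists_component hS
  refine ⟨C, ?_, fun R' hR' => ?_, fun x hx y hy => joined_componentCompl C hx hy, ?_⟩
  · exact Set.disjoint_left.2 fun x hx hxS => hx.1 hxS
  · obtain ⟨C', h, h'⟩ := GraphEnd.equivalent hR hR' S hS
    rwa [R.component_unique hC h]
  · rintro x ⟨hxS, hxC⟩ y hxy hyS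
    refine ⟨hyS, ?_⟩
    rw [← hxC]
    exact SimpleGraph.ConnectedComponent.sound
      (SimpleGraph.Adj.reachable (show (G.induce Sᶜ).Adj ⟨_, _⟩ ⟨_, _⟩ from hxy.symm))

/-- Rays with tails in arbitrarily remote connected sets that contain tails of `ω`-rays are
`ω`-rays. -/
theorem GraphEnd.mem_rays_of_joined {ω : GraphEnd G} {Q : Ray G}
    (h : ∀ S : Set V, S.Finite → ∃ M : Set V, Disjoint M S ∧ Q.HasTailIn M ∧
      (∀ R ∈ ω.rays, R.HasTailIn M) ∧ ∀ x ∈ M, ∀ y ∈ M, Joined G M x y) : Q ∈ ω.rays := by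
  obtain ⟨R, hR⟩ := ω.exists_ray
  refine GraphEnd.mem_rays_of_equivalent hR fun S hS => ?_
  obtain ⟨M, hMS, hQ, hω, hM⟩ := h S hS
  obtain ⟨C, hC⟩ := R.exists_component hS
  refine ⟨C, hQ.mono fun x hx => ?_, hC⟩
  obtain ⟨n, hn⟩ := hC.inter (hω R hR)
  obtain ⟨hnC, hnM⟩ := hn n le_rfl
  refine (hM _ hnM _ hx).induct hnC ?_
  rintro u ⟨huS, huC⟩ v _ hv huv
  refine ⟨Set.disjoint_left.1 hMS hv, ?_⟩
  rw [← huC]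
  exact SimpleGraph.ConnectedComponent.sound
    (SimpleGraph.Adj.reachable (show (G.induce Sᶜ).Adj ⟨_, _⟩ ⟨_, _⟩ from huv.symm))

/-- A separation of finite order has one side in which all `ω`-rays have their tails. -/
theorem GraphEnd.tails_dichotomy (ω : GraphEnd G) (s : Separation G) (hs : (s.A ∩ s.B).Finite) :
    (∀ R ∈ ω.rays, R.HasTailIn (s.B \ s.A)) ∨ ∀ R ∈ ω.rays, R.HasTailIn (s.A \ s.B) := by
  obtain ⟨M, hMS, hω, hM, -⟩ := ω.exists_component hs
  obtain ⟨R, hR⟩ := ω.exists_ray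
  obtain ⟨n, hn⟩ := hω R hR
  have hmem := hn n le_rfl
  have hM' : ∀ u ∈ M, u ∈ s.A → u ∉ s.B := fun u hu hA hB => Set.disjoint_left.1 hMS hu ⟨hA, hB⟩
  by_cases hB : R.vertex n ∈ s.B
  · refine Or.inl fun R' hR' => (hω R' hR').mono fun x hx => ?_
    have := s.swap.notMem_B_of_joined (fun u hu hB hA => hM' u hu hA hB) (hM _ hmem _ hx)
      fun hA => hM' _ hmem hA hB
    exact ⟨(s.mem_or x).resolve_left this, this⟩
  · refine Or.inr fun R' hR' => (hω R' hR').mono fun x hx => ?_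
    have := s.notMem_B_of_joined hM' (hM _ hmem _ hx) hB
    exact ⟨(s.mem_or x).resolve_right this, this⟩

theorem Ray.not_hasTailIn_of_disjoint {R : Ray G} {U W : Set V} (h : R.HasTailIn U)
    (hUW : Disjoint U W) : ¬ R.HasTailIn W := by
  intro h'
  obtain ⟨n, hn⟩ := h.inter h'
  exact Set.disjoint_left.1 hUW (hn n le_rfl).1 (hn n le_rfl).2

/-- A single `ω`-ray with infinitely many vertices in `B` decides the orientation. -/
theorem GraphEnd.tails_of_frequently {ω : GraphEnd G} {s : Separation G}
    (hs : (s.A ∩ s.B).Finite) {R : Ray G} (hR : R ∈ ω.rays) (h : ¬ R.HasTailIn (s.A \ s.B)) :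
    ∀ R ∈ ω.rays, R.HasTailIn (s.B \ s.A) :=
  (ω.tails_dichotomy s hs).resolve_right fun h' => h (h' R hR)

theorem GraphEnd.tails_of_mem_tangle {ω : GraphEnd G} {s : FinSep G} (hs : s ∈ ω.tangle) :
    ∀ R ∈ ω.rays, R.HasTailIn (s.1.B \ s.1.A) := by
  obtain ⟨R, hR⟩ := ω.exists_ray
  exact GraphEnd.tails_of_frequently s.2 hR
    (Ray.not_hasTailIn_of_disjoint (hs R hR) Set.disjoint_sdiff_right)

/-- The separation `(B, A)`, of the same finite order. -/
def FinSep.swap (s : FinSep G) : FinSep G := ⟨s.1.swap, by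
  rw [show s.1.swap.A ∩ s.1.swap.B = s.1.A ∩ s.1.B from Set.inter_comm _ _]; exact s.2⟩

theorem GraphEnd.swap_mem_tangle {ω : GraphEnd G} {s : FinSep G} (hs : s ∉ ω.tangle) :
    s.swap ∈ ω.tangle := by
  rcases ω.tails_dichotomy s.1 s.2 with h | h
  · exact absurd (fun R hR => (h R hR).mono Set.sdiff_subset) hs
  · exact fun R hR => (h R hR).mono Set.sdiff_subset

/-- A ray that starts in `A` and has a tail in `B` meets `A ∩ B`. -/
theorem Ray.exists_mem_inter {R : Ray G} {s : Separation G} (h : R.HasTailIn s.B) {n : ℕ}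
    (hn : R.vertex n ∈ s.A) : ∃ m, R.vertex m ∈ s.A ∩ s.B := by
  by_contra! hno
  obtain ⟨N, hN⟩ := h
  have := s.notMem_B_of_joined (U := R.verts) (fun u ⟨i, hi⟩ hA hB => hno i (hi ▸ ⟨hA, hB⟩))
    (R.joined (le_max_left n N) fun i _ _ => ⟨i, rfl⟩) (fun hB => hno n ⟨hn, hB⟩)
  exact this (hN _ (le_max_right n N))

/-! ### Dominating vertices -/

/-- The paths share only `v`, so picking from each a vertex of `T` other than `v` would inject an
infinite set into `T`. -/
theorem DominatesRay.exists_path {v : V} {R : Ray G} (h : DominatesRay v R) {T : Set V}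
    (hT : T.Finite) : ∃ w ∈ R.verts, w ≠ v ∧ ∃ p : G.Path v w, ∀ u ∈ p.1.support, u ∈ T → u = v := by
  obtain ⟨F, hF, hFR, hdis⟩ := h
  by_contra! hno
  -- The trivial path may belong to `F`; without it, every path ends away from `v`.
  have hinf : (F \ {⟨v, SimpleGraph.Path.nil⟩}).Infinite := hF.sdiff (Set.finite_singleton _)
  have hne : ∀ P ∈ F \ {⟨v, SimpleGraph.Path.nil⟩}, P.1 ≠ v := by
    rintro ⟨w, p⟩ ⟨-, hP⟩ hw
    obtain rfl : w = v := hw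
    exact hP (by rw [SimpleGraph.Path.loop_eq p]; rfl)
  have hch : ∀ P : ↥(F \ {⟨v, SimpleGraph.Path.nil⟩}), ∃ u : V,
      u ∈ P.1.2.1.support ∧ u ∈ T ∧ u ≠ v := fun P =>
    hno P.1.1 (hFR _ P.2.1) (hne _ P.2) P.1.2
  choose g hg using hch
  have hinj : Function.Injective g := by
    intro P Q hPQ
    by_contra hne'
    refine (hg P).2.2 (hdis P.2.1 Q.2.1 (fun h => hne' (Subtype.ext h)) _ (hg P).1 ?_)
    rw [hPQ]
    exact (hg Q).1
  have := hinf.to_subtype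
  exact (Set.infinite_range_of_injective hinj) (hT.subset (by
    rintro _ ⟨P, rfl⟩
    exact (hg P).2.1))

/-- Outside any finite set, a dominating vertex has a neighbour that is joined to a given tail. -/
theorem DominatesRay.exists_adj_joined {v : V} {R : Ray G} (h : DominatesRay v R) {T : Set V}
    (hT : T.Finite) (n : ℕ) : ∃ y ∉ T, G.Adj v y ∧ ∃ m ≥ n, R.vertex m ∉ T ∧
      Joined G (T ∪ {v})ᶜ y (R.vertex m) := by
  -- Avoiding the first `n` vertices of `R` as well forces the endpoint into the required tail.
  obtain ⟨_, ⟨m, rfl⟩, hwv, ⟨p, hp⟩, hpT⟩ :=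
    h.exists_path (hT.union ((Set.finite_lt_nat n).image R.vertex))
  cases p with
  | nil => exact absurd rfl hwv
  | @cons _ y _ hvy q =>
    rw [SimpleGraph.Walk.cons_isPath_iff] at hp
    have hq : ∀ u ∈ q.support, u ∉ T ∪ R.vertex '' {i | i < n} ∧ u ≠ v := by
      intro u hu
      have huv : u ≠ v := fun h => hp.2 (h ▸ hu)
      exact ⟨fun hT' => huv (hpT u (by simp [hu]) hT'), huv⟩
    refine ⟨y, fun hy => (hq y q.start_mem_support).1 (Or.inl hy), hvy, m, ?_,
      fun hm => (hq _ q.end_mem_support).1 (Or.inl hm), Joined.of_walk q fun u hu => ?_⟩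
    · by_contra hlt
      exact (hq _ q.end_mem_support).1 (Or.inr ⟨m, not_le.1 hlt, rfl⟩)
    · rintro (hu' | hu')
      · exact (hq u hu).1 (Or.inl hu')
      · exact (hq u hu).2 hu'

/-- From a vertex outside `B`, some path to the tail of `R` in `B` would avoid the finite separator,
which is impossible. -/
theorem GraphEnd.IsDominatedBy.mem_B {ω : GraphEnd G} {v : V} (hv : ω.IsDominatedBy v)
    {s : FinSep G} (hs : s ∈ ω.tangle) : v ∈ s.1.B := by
  obtain ⟨R, hR, hdom⟩ := hv
  by_contra hvB
  obtain ⟨n, hn⟩ := hs R hR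
  obtain ⟨y, hy, hvy, m, hm, hmT, hj⟩ := hdom.exists_adj_joined s.2 n
  have hyB : y ∉ s.1.B := fun hB => hy ⟨s.1.mem_A_of_adj hvB hvy, hB⟩
  exact s.1.notMem_B_of_joined (U := (s.1.A ∩ s.1.B ∪ {v})ᶜ)
    (fun u hu hA hB => hu (Or.inl ⟨hA, hB⟩)) hj hyB (hn m hm)

/-- If no tangle separation cuts `v` off, then no finite set avoiding `v` separates `v` from `R`,
and infinitely many paths disjoint except at `v` can be chosen greedily. -/
theorem GraphEnd.exists_mem_tangle_of_not_isDominatedBy {ω : GraphEnd G} {v : V}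
    (hv : ¬ ω.IsDominatedBy v) : ∃ s ∈ ω.tangle, v ∉ s.1.B := by
  classical
  by_contra! hno
  obtain ⟨R, hR⟩ := ω.exists_ray
  refine hv ⟨R, hR, ?_⟩
  have hpath : ∀ F : Set V, F.Finite → v ∉ F → ∃ w ∈ R.verts, w ≠ v ∧
      ∃ p : G.Path v w, ∀ u ∈ p.1.support, u ∉ F := by
    intro F hF hvF
    -- `K` is the component of `v` in `G - F`. If it missed `R` apart from `v`, then `(K ∪ F, Kᶜ)`
    -- would be in the tangle and cut `v` off.
    set K : Set V := {u | Joined G Fᶜ v u} with hK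
    have hKF : ∀ u ∈ K, u ∉ F := fun u hu => hu.mem (U := Fᶜ) hvF
    have hvK : v ∈ K := Relation.ReflTransGen.refl
    let s : Separation G :=
      { A := K ∪ F
        B := Kᶜ
        union_eq := by ext x; by_cases hx : x ∈ K <;> simp [hx]
        not_adj := by
          rintro a ⟨-, ha⟩ b ⟨hb, hb'⟩ hab
          have haK : a ∈ K := not_not.1 ha
          exact hb (Relation.ReflTransGen.tail haK ⟨hKF a haK, fun h => hb' (Or.inr h), hab⟩) }
    have hfin : (s.A ∩ s.B).Finite := hF.subset (by
      rintro x ⟨hx | hx, hx'⟩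
      · exact absurd hx hx'
      · exact hx)
    by_contra! hno'
    have hmem : (⟨s, hfin⟩ : FinSep G) ∈ ω.tangle := by
      intro R' hR'
      refine (GraphEnd.tails_of_frequently hfin hR ?_ R' hR').mono Set.sdiff_subset
      intro hT
      obtain ⟨n, hn⟩ := hT.inter (R.hasTailIn_compl (Set.finite_singleton v))
      obtain ⟨⟨-, h1⟩, h2⟩ := hn n le_rfl
      obtain ⟨p, hp⟩ := Joined.exists_path (not_not.1 h1 : R.vertex n ∈ K) hvF
      obtain ⟨u, hu, huF⟩ := hno' _ ⟨n, rfl⟩ h2 p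
      exact hp u hu huF
    exact hno _ hmem hvK
  obtain ⟨f, hf, hfr⟩ := exists_seq_of_forall_finset_exists
    (fun P : Σ w : V, G.Path v w => P.1 ∈ R.verts ∧ P.1 ≠ v)
    (fun P Q => ∀ u, u ∈ P.2.1.support → u ∈ Q.2.1.support → u = v) (by
      intro s _
      obtain ⟨w, hw, hwv, p, hp⟩ := hpath
        ((s.biUnion fun P => P.2.1.support.toFinset).erase v : Finset V)
        (Finset.finite_toSet _) (by simp)
      refine ⟨⟨w, p⟩, ⟨hw, hwv⟩, fun P hP u hu hu' => ?_⟩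
      by_contra huv
      refine hp u hu' ?_
      simp only [Finset.coe_erase, Finset.coe_biUnion, Set.mem_sdiff, Set.mem_iUnion,
        Set.mem_singleton_iff]
      exact ⟨⟨P, hP, by simpa using hu⟩, huv⟩)
  have hinj : Function.Injective f := by
    intro m n hmn
    by_contra hne
    rcases lt_or_gt_of_ne hne with h | h
    · exact (hf m).2 (hfr m n h _ (f m).2.1.end_mem_support (hmn ▸ (f m).2.1.end_mem_support))
    · exact (hf m).2 (hfr n m h _ (hmn ▸ (f m).2.1.end_mem_support) (f m).2.1.end_mem_support)
  refine ⟨Set.range f, Set.infinite_range_of_injective hinj, ?_, ?_⟩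
  · rintro _ ⟨n, rfl⟩
    exact (hf n).1
  · rintro _ ⟨m, rfl⟩ _ ⟨n, rfl⟩ hne u hu hu'
    rcases lt_trichotomy m n with h | rfl | h
    · exact hfr m n h u hu hu'
    · exact absurd rfl hne
    · exact hfr n m h u hu' hu

/-! ### Relative deciders from disjoint rays and dominating vertices -/

theorem exists_finset_joined {M : Set V} (hM : ∀ x ∈ M, ∀ y ∈ M, Joined G M x y) {w : V}
    (hw : w ∈ M) (Q : Finset V) (hQ : ↑Q ⊆ M) :
    ∃ W : Finset V, ↑W ⊆ M ∧ w ∈ W ∧ ∀ q ∈ Q, Joined G ↑W w q := by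
  classical
  induction Q using Finset.induction_on with
  | empty => exact ⟨{w}, by simpa using hw, by simp, by simp⟩
  | insert q Q _ ih =>
    rw [Finset.coe_insert, Set.insert_subset_iff] at hQ
    obtain ⟨W, hWM, hwW, hW⟩ := ih hQ.2
    obtain ⟨W', hWM', -, -, hW'⟩ := (hM w hw q hQ.1).exists_finset hw
    refine ⟨W ∪ W', by simpa using ⟨hWM, hWM'⟩, by simp [hwW], fun p hp => ?_⟩
    rcases Finset.mem_insert.1 hp with rfl | hp
    · exact hW'.mono (by simp)
    · exact (hW p hp).mono (by simp)

/-- Inside `W`, the vertex `w` is joined to each of the rays `ρ i` and to a neighbour of each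
vertex in `D`. -/
def IsHub {ι : Type*} (ρ : ι → Ray G) (D : Finset V) (W : Finset V) (w : V) : Prop :=
  w ∈ W ∧ (∀ i, ∃ n, Joined G ↑W w ((ρ i).vertex n)) ∧
    ∀ d ∈ D, ∃ y, G.Adj d y ∧ Joined G ↑W w y

theorem IsHub.mono {ι : Type*} {ρ : ι → Ray G} {D W W' : Finset V} {w : V}
    (h : IsHub ρ D W w) (hW : W ⊆ W') : IsHub ρ D W' w := by
  have hW' : (W : Set V) ⊆ W' := by exact_mod_cast hW
  exact ⟨hW h.1, fun i => (h.2.1 i).imp fun n hn => hn.mono hW',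
    fun d hd => (h.2.2 d hd).imp fun y hy => ⟨hy.1, hy.2.mono hW'⟩⟩

theorem GraphEnd.exists_isHub {ω : GraphEnd G} {ι : Type*} [Fintype ι] {ρ : ι → Ray G}
    (hρ : ∀ i, ρ i ∈ ω.rays) {D : Finset V} (hD : ∀ d ∈ D, ω.IsDominatedBy d) {R : Ray G}
    (hR : R ∈ ω.rays) {F : Set V} (hF : F.Finite) :
    ∃ (W : Finset V) (a : ℕ), Disjoint ↑W F ∧ IsHub ρ D W (R.vertex a) := by
  classical
  obtain ⟨M, hMF, hω, hM, hclosed⟩ := ω.exists_component hF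
  obtain ⟨a, ha⟩ := hω R hR
  have hray : ∀ i, ∃ n, (ρ i).vertex n ∈ M := fun i =>
    let ⟨n, hn⟩ := hω _ (hρ i)
    ⟨n, hn n le_rfl⟩
  have hnbr : ∀ d : D, ∃ y ∈ M, G.Adj d y := by
    rintro ⟨d, hd⟩
    obtain ⟨R', hR', hdom⟩ := hD d hd
    obtain ⟨n, hn⟩ := hω R' hR'
    -- The walk from `y` avoids `F` and ends in the component `M`, so `y` is already in `M`.
    obtain ⟨y, -, hdy, m, hm, -, hj⟩ := hdom.exists_adj_joined hF n
    exact ⟨y, hj.symm.induct (hn m hm) fun u hu v _ hv huv =>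
      hclosed u hu v huv fun h => hv (Or.inl h), hdy⟩
  choose n hn using hray
  choose y hy hdy using hnbr
  obtain ⟨W, hWM, haW, hW⟩ := exists_finset_joined hM (ha a le_rfl)
    (Finset.univ.image (fun i => (ρ i).vertex (n i)) ∪ Finset.univ.image y) (by
      intro x hx
      simp only [Finset.coe_union, Finset.coe_image, Finset.coe_univ, Set.image_univ,
        Set.mem_union, Set.mem_range] at hx
      rcases hx with ⟨i, rfl⟩ | ⟨d, rfl⟩
      · exact hn i
      · exact hy d)
  exact ⟨W, a, hMF.mono_left hWM, haW, fun i => ⟨n i, hW _ (by simp)⟩,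
    fun d hd => ⟨y ⟨d, hd⟩, hdy ⟨d, hd⟩, hW _ (by simp)⟩⟩

/-- If `W` missed the separator, everything joined to `w` in `W` would lie outside `B`. Then each
ray crosses `A ∩ B` on its way to its tail, and each `d ∈ D` lies in `A` through its neighbour and
in `B` by domination: too many distinct separator vertices. -/
theorem IsHub.exists_mem_inter {ω : GraphEnd G} {ι : Type*} [Fintype ι] {ρ : ι → Ray G}
    (hρ : ∀ i, ρ i ∈ ω.rays) (hdis : Pairwise fun i j => Disjoint (ρ i).verts (ρ j).verts)
    {D : Finset V} (hD : ∀ d ∈ D, ω.IsDominatedBy d) (hρD : ∀ i, Disjoint (ρ i).verts ↑D)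
    {W : Finset V} {w : V} (hub : IsHub ρ D W w) {s : FinSep G} (hs : s ∈ ω.tangle)
    (hk : s.1.order < (Fintype.card ι + D.card : ℕ)) {x r : V} (hx : x ∉ s.1.B)
    (hxr : G.Adj x r) (hr : r ∈ W) (hrw : Joined G ↑W r w) : ∃ u ∈ W, u ∈ s.1.A ∩ s.1.B := by
  classical
  by_contra! hno
  have hno' : ∀ u ∈ (W : Set V), u ∈ s.1.A → u ∉ s.1.B := fun u hu hA hB => hno u hu ⟨hA, hB⟩
  have hwB : w ∉ s.1.B :=
    s.1.notMem_B_of_joined hno' hrw (hno' r hr (s.1.mem_A_of_adj hx hxr))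
  have hDs : ∀ d ∈ D, d ∈ s.1.A ∩ s.1.B := by
    intro d hd
    obtain ⟨y, hdy, hj⟩ := hub.2.2 d hd
    exact ⟨s.1.mem_A_of_adj (s.1.notMem_B_of_joined hno' hj hwB) hdy.symm, (hD d hd).mem_B hs⟩
  have hρs : ∀ i, ∃ n, (ρ i).vertex n ∈ s.1.A ∩ s.1.B := by
    intro i
    obtain ⟨n, hj⟩ := hub.2.1 i
    have := s.1.notMem_B_of_joined hno' hj hwB
    exact Ray.exists_mem_inter (hs _ (hρ i)) ((s.1.mem_or _).resolve_right this)
  choose n hn using hρs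
  have hinj : Function.Injective fun i => (ρ i).vertex (n i) := by
    intro i j hij
    by_contra hne
    exact Set.disjoint_left.1 (hdis hne) ⟨n i, rfl⟩ ⟨n j, hij.symm⟩
  have hdisj : Disjoint (Finset.univ.image fun i => (ρ i).vertex (n i)) D := by
    rw [Finset.disjoint_left]
    intro v hv hvD
    obtain ⟨i, -, rfl⟩ := Finset.mem_image.1 hv
    exact Set.disjoint_left.1 (hρD i) ⟨n i, rfl⟩ hvD
  have hle : (((Finset.univ.image fun i => (ρ i).vertex (n i)) ∪ D : Finset V) : Set V).encard ≤
      s.1.order := by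
    refine Set.encard_le_encard fun v hv => ?_
    rcases Finset.mem_union.1 (Finset.mem_coe.1 hv) with hv | hv
    · obtain ⟨i, -, rfl⟩ := Finset.mem_image.1 hv
      exact hn i
    · exact hDs v hv
  rw [Set.encard_coe_eq_coe_finsetCard, Finset.card_union_of_disjoint hdisj,
    Finset.card_image_of_injective _ hinj, Finset.card_univ] at hle
  exact absurd hk (not_lt.2 hle)

/-- Outside any finite set there is a vertex `x` that can be cut off from `ω` by a small
separation only at the price of two separator vertices close to `x`. -/
theorem GraphEnd.exists_guarded_vertex {ω : GraphEnd G} {ι : Type*} [Fintype ι] {ρ : ι → Ray G}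
    (hρ : ∀ i, ρ i ∈ ω.rays) (hdis : Pairwise fun i j => Disjoint (ρ i).verts (ρ j).verts)
    {D : Finset V} (hD : ∀ d ∈ D, ω.IsDominatedBy d) (hρD : ∀ i, Disjoint (ρ i).verts ↑D)
    {F : Set V} (hF : F.Finite) :
    ∃ (Y : Finset V) (x : V), x ∈ Y ∧ Disjoint ↑Y F ∧ ∀ s ∈ ω.tangle,
      s.1.order < (Fintype.card ι + D.card : ℕ) → x ∉ s.1.B →
      ∃ u ∈ Y, ∃ v ∈ Y, u ≠ v ∧ u ∈ s.1.A ∩ s.1.B ∧ v ∈ s.1.A ∩ s.1.B := by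
  classical
  obtain ⟨R, hR⟩ := ω.exists_ray
  obtain ⟨N, hN⟩ := R.hasTailIn_compl hF
  -- Avoiding the first `N` vertices of `R` too gives `N ≤ a`, so the segment of `R` from `a` on
  -- misses `F`.
  obtain ⟨W₁, a, hW₁F, hub₁⟩ := ω.exists_isHub hρ hD hR
    (hF.union ((Set.finite_lt_nat N).image R.vertex))
  rw [Set.disjoint_union_right] at hW₁F
  have haN : N ≤ a := by
    by_contra h
    exact Set.disjoint_left.1 hW₁F.2 hub₁.1 ⟨a, not_le.1 h, rfl⟩
  obtain ⟨b', hb'⟩ := R.hasTailIn_compl W₁.finite_toSet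
  -- The guarded vertex will be `R.vertex (b + 1)`: its neighbours at `b` and `b + 2` lead along `R`
  -- back to the first hub and on to the second.
  obtain ⟨b, hab, hb⟩ : ∃ b, a ≤ b ∧ ∀ m, b ≤ m → R.vertex m ∉ W₁ :=
    ⟨max a b', le_max_left _ _, fun m hm => hb' m (le_of_max_le_right hm)⟩
  set U₁ : Finset V := W₁ ∪ (Finset.Icc a b).image R.vertex with hU₁
  have hU₁R : ∀ m, b < m → R.vertex m ∉ U₁ := by
    intro m hm hmem
    rcases Finset.mem_union.1 hmem with h | h
    · exact hb m hm.le h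
    · obtain ⟨i, hi, hi'⟩ := Finset.mem_image.1 h
      have := R.injective hi'
      have := (Finset.mem_Icc.1 hi).2
      omega
  obtain ⟨W₂, c, hW₂F, hub₂⟩ := ω.exists_isHub hρ hD hR
    ((hF.union ((Set.finite_lt_nat (b + 2)).image R.vertex)).union U₁.finite_toSet)
  rw [Set.disjoint_union_right, Set.disjoint_union_right] at hW₂F
  have hbc : b + 2 ≤ c := by
    by_contra h
    exact Set.disjoint_left.1 hW₂F.1.2 hub₂.1 ⟨c, not_le.1 h, rfl⟩
  set U₂ : Finset V := W₂ ∪ (Finset.Icc (b + 2) c).image R.vertex with hU₂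
  have hRU₁ : ∀ i, a ≤ i → i ≤ b → R.vertex i ∈ U₁ := fun i hi hi' =>
    Finset.mem_union_right _ (Finset.mem_image_of_mem _ (Finset.mem_Icc.2 ⟨hi, hi'⟩))
  have hRU₂ : ∀ i, b + 2 ≤ i → i ≤ c → R.vertex i ∈ U₂ := fun i hi hi' =>
    Finset.mem_union_right _ (Finset.mem_image_of_mem _ (Finset.mem_Icc.2 ⟨hi, hi'⟩))
  have hU₁₂ : Disjoint U₁ U₂ := by
    rw [Finset.disjoint_left]
    intro v hv₁ hv₂
    rcases Finset.mem_union.1 hv₂ with h | h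
    · exact Set.disjoint_left.1 hW₂F.2 h hv₁
    · obtain ⟨i, hi, rfl⟩ := Finset.mem_image.1 h
      have := (Finset.mem_Icc.1 hi).1
      exact hU₁R i (by omega) hv₁
  refine ⟨insert (R.vertex (b + 1)) (U₁ ∪ U₂), R.vertex (b + 1), Finset.mem_insert_self _ _, ?_, ?_⟩
  · rw [Set.disjoint_left]
    intro v hv hvF
    have hRF : ∀ i, N ≤ i → R.vertex i ≠ v := fun i hi h => hN i hi (h ▸ hvF)
    simp only [hU₁, hU₂, Finset.coe_insert, Finset.coe_union, Finset.coe_image, Set.mem_insert_iff,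
      Set.mem_union, Set.mem_image, Finset.mem_coe, Finset.mem_Icc] at hv
    rcases hv with rfl | (hv | ⟨i, hi, rfl⟩) | hv | ⟨i, hi, rfl⟩
    · exact hRF (b + 1) (by omega) rfl
    · exact Set.disjoint_left.1 hW₁F.1 hv hvF
    · exact hRF i (by omega) rfl
    · exact Set.disjoint_left.1 hW₂F.1.1 hv hvF
    · exact hRF i (by omega) rfl
  · intro s hs hk hx
    obtain ⟨u, hu, hu'⟩ := IsHub.exists_mem_inter hρ hdis hD hρD
      (hub₁.mono Finset.subset_union_left) hs hk hx (R.adj b).symm (hRU₁ b hab le_rfl)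
      (R.joined hab hRU₁).symm
    obtain ⟨v, hv, hv'⟩ := IsHub.exists_mem_inter hρ hdis hD hρD
      (hub₂.mono Finset.subset_union_left) hs hk hx (R.adj (b + 1)) (hRU₂ (b + 2) le_rfl hbc)
      (R.joined hbc hRU₂)
    refine ⟨u, Finset.mem_insert_of_mem (Finset.mem_union_left _ hu), v,
      Finset.mem_insert_of_mem (Finset.mem_union_right _ hv), ?_, hu', hv'⟩
    rintro rfl
    exact Finset.disjoint_left.1 hU₁₂ hu hv

/-- The decider is `D` with `m` guarded vertices whose guarding sets are disjoint from each other
and from `D`, so that no separator vertex is counted twice. -/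
theorem GraphEnd.exists_isRelativeDecider {ω : GraphEnd G} {m : ℕ} {ρ : Fin m → Ray G}
    (hρ : ∀ i, ρ i ∈ ω.rays) (hdis : Pairwise fun i j => Disjoint (ρ i).verts (ρ j).verts)
    {D : Finset V} (hD : ∀ d ∈ D, ω.IsDominatedBy d) (hρD : ∀ i, Disjoint (ρ i).verts ↑D) :
    ∃ X : Finset V, X.card = m + D.card ∧
      IsRelativeDecider ↑X (ω.tangle ∩ sepsBelow G (m + D.card)) := by
  classical
  obtain ⟨f, hf, hfr⟩ := exists_seq_of_forall_finset_exists
    (fun p : Finset V × V => p.2 ∈ p.1 ∧ Disjoint p.1 D ∧ ∀ s ∈ ω.tangle,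
      s.1.order < (m + D.card : ℕ) → p.2 ∉ s.1.B →
      ∃ u ∈ p.1, ∃ v ∈ p.1, u ≠ v ∧ u ∈ s.1.A ∩ s.1.B ∧ v ∈ s.1.A ∩ s.1.B)
    (fun p q => Disjoint p.1 q.1) (by
      intro t _
      obtain ⟨Y, x, hx, hY, h⟩ := ω.exists_guarded_vertex hρ hdis hD hρD
        (F := (t.biUnion Prod.fst ∪ D : Finset V)) (Finset.finite_toSet _)
      rw [Fintype.card_fin] at h
      rw [Finset.disjoint_coe, Finset.disjoint_union_right] at hY
      exact ⟨(Y, x), ⟨hx, hY.2, h⟩, fun p hp =>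
        (hY.1.mono_right (Finset.subset_biUnion_of_mem Prod.fst hp)).symm⟩)
  have hfdis : ∀ i j, i ≠ j → Disjoint (f i).1 (f j).1 := fun i j hij =>
    (lt_or_gt_of_ne hij).elim (hfr i j) fun h => (hfr j i h).symm
  have hinj : Function.Injective fun i => (f i).2 := by
    intro i j hij
    by_contra hne
    refine Finset.disjoint_left.1 (hfdis i j hne) (hf i).1 ?_
    rw [show (f i).2 = (f j).2 from hij]
    exact (hf j).1
  have hXD : Disjoint D ((Finset.range m).image fun i => (f i).2) := by
    rw [Finset.disjoint_right]
    intro v hv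
    obtain ⟨i, -, rfl⟩ := Finset.mem_image.1 hv
    exact Finset.disjoint_left.1 (hf i).2.1 (hf i).1
  refine ⟨D ∪ (Finset.range m).image fun i => (f i).2, ?_, ?_⟩
  · rw [Finset.card_union_of_disjoint hXD, Finset.card_image_of_injective _ hinj,
      Finset.card_range, add_comm]
  rintro s ⟨hs, hk⟩
  set c : Finset V := s.2.toFinset with hc
  have hcmem : ∀ v, v ∈ c ↔ v ∈ s.1.A ∩ s.1.B := fun v => s.2.mem_toFinset
  have hcard : c.card < m + D.card := by
    have : s.1.order = c.card := s.2.encard_eq_coe_toFinset_card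
    have hk' : s.1.order < ((m + D.card : ℕ) : ℕ∞) := hk
    rw [this] at hk'
    exact_mod_cast hk'
  have hcount : ∀ A : Set V, Cardinal.mk
      ↥(A ∩ ↑(D ∪ (Finset.range m).image fun i => (f i).2)) =
      (((D.filter (· ∈ A)).card + ∑ i ∈ Finset.range m, if (f i).2 ∈ A then 1 else 0 : ℕ) :
        Cardinal) := by
    intro A
    rw [show A ∩ ↑(D ∪ (Finset.range m).image fun i => (f i).2) =
      ↑((D ∪ (Finset.range m).image fun i => (f i).2).filter (· ∈ A)) by
        ext; simp only [Set.mem_inter_iff, Finset.mem_coe, Finset.mem_filter]; tauto]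
    rw [Finset.coe_sort_coe, Cardinal.mk_coe_finset, Finset.filter_union,
      Finset.card_union_of_disjoint (Finset.disjoint_filter_filter hXD), Finset.card_filter
      (· ∈ A) (Finset.image _ _), Finset.sum_image hinj.injOn]
  rw [hcount, hcount, Nat.cast_lt]
  have hDB : D.filter (· ∈ s.1.B) = D :=
    Finset.filter_true_of_mem fun d hd => (hD d hd).mem_B hs
  rw [hDB]
  have hsum : (D.filter (· ∈ s.1.A)).card + ∑ i ∈ Finset.range m, ((f i).1 ∩ c).card ≤ c.card := by
    rw [← Finset.card_biUnion fun i _ j _ hij =>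
      (hfdis i j hij).mono Finset.inter_subset_left Finset.inter_subset_left,
      ← Finset.card_union_of_disjoint]
    · refine Finset.card_le_card fun v hv => ?_
      rcases Finset.mem_union.1 hv with hv | hv
      · rw [Finset.mem_filter] at hv
        exact (hcmem v).2 ⟨hv.2, (hD v hv.1).mem_B hs⟩
      · obtain ⟨i, -, hi⟩ := Finset.mem_biUnion.1 hv
        exact (Finset.mem_inter.1 hi).2
    · rw [Finset.disjoint_left]
      intro v hv hv'
      obtain ⟨i, -, hi⟩ := Finset.mem_biUnion.1 hv'
      exact Finset.disjoint_left.1 (hf i).2.1 (Finset.mem_inter.1 hi).1 (Finset.mem_filter.1 hv).1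
  -- A guarded vertex in `A ∩ B` is itself a separator vertex in its guarding set; one only in `B`
  -- needs none; one only in `A` forces two. Summed over `i` and combined with `hsum` and `hcard`,
  -- this gives the strict majority.
  have hlocal : ∀ i ∈ Finset.range m, (if (f i).2 ∈ s.1.A then 1 else 0) + 1 ≤
      ((f i).1 ∩ c).card + if (f i).2 ∈ s.1.B then 1 else 0 := by
    intro i _
    by_cases hB : (f i).2 ∈ s.1.B
    · by_cases hA : (f i).2 ∈ s.1.A
      · have : 0 < ((f i).1 ∩ c).card :=
          Finset.card_pos.2 ⟨_, Finset.mem_inter.2 ⟨(hf i).1, (hcmem _).2 ⟨hA, hB⟩⟩⟩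
        simp only [hA, hB, if_true]
        omega
      · simp [hA, hB]
    · obtain ⟨u, hu, v, hv, huv, hu', hv'⟩ := (hf i).2.2 s hs hk hB
      have : 1 < ((f i).1 ∩ c).card := Finset.one_lt_card.2
        ⟨u, Finset.mem_inter.2 ⟨hu, (hcmem _).2 hu'⟩, v, Finset.mem_inter.2 ⟨hv, (hcmem _).2 hv'⟩,
          huv⟩
      simp only [hB, if_false]
      split_ifs <;> omega
  have := Finset.sum_le_sum hlocal
  rw [Finset.sum_add_distrib, Finset.sum_add_distrib, Finset.sum_const, Finset.card_range,
    smul_eq_mul, mul_one] at this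
  omega

/-- The ray obtained by deleting the first `n` vertices. -/
def Ray.drop (R : Ray G) (n : ℕ) : Ray G where
  vertex := fun i => R.vertex (n + i)
  injective := fun i j h => by have := R.injective h; omega
  adj := fun i => R.adj (n + i)

theorem GraphEnd.drop_mem_rays {ω : GraphEnd G} {R : Ray G} (hR : R ∈ ω.rays) (n : ℕ) :
    R.drop n ∈ ω.rays := by
  refine GraphEnd.mem_rays_of_equivalent hR fun S hS => ?_
  obtain ⟨C, N, hN⟩ := R.exists_component hS
  exact ⟨C, ⟨N, fun m hm => hN (n + m) (by omega)⟩, N, hN⟩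

theorem GraphEnd.exists_isRelativeDecider_of_le (ω : GraphEnd G) {k : ℕ}
    (hk : (k : ℕ∞) ≤ ω.degree + ω.dom) :
    ∃ X : Set V, X.encard = k ∧ IsRelativeDecider X (ω.tangle ∩ sepsBelow G k) := by
  classical
  obtain ⟨m, n, hmn, hm, hn⟩ : ∃ m n : ℕ, m + n = k ∧ (m : ℕ∞) ≤ ω.degree ∧ (n : ℕ∞) ≤ ω.dom := by
    -- If `dom ω < k`, it is finite and cancelling it leaves `k - dom ω ≤ deg ω`; otherwise no rays
    -- are needed.
    by_cases h : (k : ℕ∞) ≤ ω.dom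
    · exact ⟨0, k, by simp, by simp, h⟩
    · obtain ⟨n, hn⟩ := ENat.ne_top_iff_exists.1 (ne_top_of_lt (not_le.1 h))
      rw [← hn] at h hk ⊢
      have h' : n < k := by exact_mod_cast not_le.1 h
      refine ⟨k - n, n, by omega, ?_, le_rfl⟩
      have : ((k - n : ℕ) : ℕ∞) + n ≤ ω.degree + n := by
        rw [← Nat.cast_add, Nat.sub_add_cancel h'.le]; exact hk
      exact (ENat.add_le_add_iff_right (ENat.natCast_ne_top n)).1 this
  obtain ⟨D', hD', hD'n⟩ := Set.exists_subset_encard_eq hn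
  obtain ⟨D, rfl⟩ := (Set.finite_of_encard_eq_coe hD'n).exists_finset_coe
  rw [Set.encard_coe_eq_coe_finsetCard, Nat.cast_inj] at hD'n
  obtain ⟨ρ, hρ, hdis⟩ : ∃ ρ : Fin m → Ray G, (∀ i, ρ i ∈ ω.rays) ∧
      Pairwise fun i j => Disjoint (ρ i).verts (ρ j).verts := by
    obtain ⟨F, hF, hFm⟩ : ∃ F : Set (Ray G), (F ⊆ ω.rays ∧
        F.Pairwise fun R R' => Disjoint R.verts R'.verts) ∧ (m : ℕ∞) ≤ F.encard := by
      by_contra! hno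
      -- If all families had at most `m` rays, so would the supremum; size `0` is served by the
      -- empty family.
      rcases m with _ | m
      · exact absurd (hno ∅ ⟨by simp, by simp⟩) (by simp)
      · have : ω.degree ≤ m := iSup₂_le fun F hF => by
          have := hno F hF
          push_cast at this
          exact ENat.lt_add_one_iff (ENat.natCast_ne_top m) |>.1 this
        exact absurd (hm.trans this) (by rw [Nat.cast_le]; omega)
    obtain ⟨F', hF'F, hF'm⟩ := Set.exists_subset_encard_eq hFm
    obtain ⟨E, rfl⟩ := (Set.finite_of_encard_eq_coe hF'm).exists_finset_coe
    rw [Set.encard_coe_eq_coe_finsetCard, Nat.cast_inj] at hF'm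
    let e := (E.equivFinOfCardEq hF'm).symm
    exact ⟨fun i => e i, fun i => hF.1 (hF'F (e i).2), fun i j hij =>
      hF.2 (hF'F (e i).2) (hF'F (e j).2) fun h => hij (e.injective (Subtype.ext h))⟩
  -- Passing to tails makes the rays disjoint from `D`.
  choose N hN using fun i => (ρ i).hasTailIn_compl D.finite_toSet
  obtain ⟨X, hX, hdec⟩ := GraphEnd.exists_isRelativeDecider
    (ρ := fun i => (ρ i).drop (N i)) (D := D) (fun i => GraphEnd.drop_mem_rays (hρ i) _)
    (fun i j hij => (hdis hij).mono (by rintro _ ⟨a, rfl⟩; exact ⟨_, rfl⟩)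
      (by rintro _ ⟨a, rfl⟩; exact ⟨_, rfl⟩))
    (fun d hd => hD' hd)
    (fun i => Set.disjoint_left.2 (by rintro _ ⟨a, rfl⟩; exact hN i _ (by omega)))
  rw [hD'n, hmn] at hX hdec
  exact ⟨X, by rw [Set.encard_coe_eq_coe_finsetCard, hX], hdec⟩

/-! ### The topology on the separations of finite order -/

theorem Separation.restrict_eq_iff {s t : Separation G} {Z : Set V} :
    s.restrict Z = t.restrict Z ↔ ∀ z ∈ Z, (z ∈ s.A ↔ z ∈ t.A) ∧ (z ∈ s.B ↔ z ∈ t.B) := by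
  constructor
  · intro h z hz
    have hA : (⟨z, hz⟩ : Z) ∈ (s.restrict Z).A ↔ (⟨z, hz⟩ : Z) ∈ (t.restrict Z).A := by rw [h]
    have hB : (⟨z, hz⟩ : Z) ∈ (s.restrict Z).B ↔ (⟨z, hz⟩ : Z) ∈ (t.restrict Z).B := by rw [h]
    exact ⟨hA, hB⟩
  · intro h
    ext z
    · exact (h z z.2).1
    · exact (h z z.2).2

theorem isOpen_of_forall_agree {O : Set (FinSep G)}
    (h : ∀ p ∈ O, ∃ Z : Set V, Z.Finite ∧ ∀ s : FinSep G,
      (∀ z ∈ Z, (z ∈ s.1.A ↔ z ∈ p.1.A) ∧ (z ∈ s.1.B ↔ z ∈ p.1.B)) → s ∈ O) : IsOpen O := by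
  rw [isOpen_iff_forall_mem_open]
  intro p hp
  obtain ⟨Z, hZ, hZO⟩ := h p hp
  exact ⟨basicOpen (p.1.restrict Z), fun s hs => hZO s (Separation.restrict_eq_iff.1 hs),
    TopologicalSpace.isOpen_generateFrom_of_mem ⟨Z, hZ, _, rfl⟩, rfl⟩

/-- Finite intersections only enlarge `Z` to a finite union, so the generating sets already form
neighbourhood bases. -/
theorem exists_agree_of_isOpen {O : Set (FinSep G)} (hO : IsOpen O) {p : FinSep G} (hp : p ∈ O) :
    ∃ Z : Set V, Z.Finite ∧ ∀ s : FinSep G,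
      (∀ z ∈ Z, (z ∈ s.1.A ↔ z ∈ p.1.A) ∧ (z ∈ s.1.B ↔ z ∈ p.1.B)) → s ∈ O := by
  induction hO with
  | basic O hO =>
    obtain ⟨Z, hZ, t, rfl⟩ := hO
    exact ⟨Z, hZ, fun s hs => (Separation.restrict_eq_iff.2 hs).trans hp⟩
  | univ => exact ⟨∅, Set.finite_empty, fun _ _ => trivial⟩
  | inter O O' _ _ ih ih' =>
    obtain ⟨Z, hZ, h⟩ := ih hp.1
    obtain ⟨Z', hZ', h'⟩ := ih' hp.2
    exact ⟨Z ∪ Z', hZ.union hZ', fun s hs =>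
      ⟨h s fun z hz => hs z (Or.inl hz), h' s fun z hz => hs z (Or.inr hz)⟩⟩
  | sUnion T _ ih =>
    obtain ⟨O, hO, hpO⟩ := hp
    obtain ⟨Z, hZ, h⟩ := ih O hO hpO
    exact ⟨Z, hZ, fun s hs => ⟨O, hO, h s hs⟩⟩

theorem Separation.swap_order (s : Separation G) : s.swap.order = s.order := by
  rw [Separation.order, Separation.order, Set.inter_comm]
  rfl

/-- If `p` has order less than `k` but is not in the tangle, its swap is, so `X` votes against `p`
and hence against everything agreeing with `p` on `X`. -/
theorem GraphEnd.isClosed_of_isRelativeDecider (ω : GraphEnd G) {k : ℕ} {X : Set V}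
    (hX : X.Finite) (hdec : IsRelativeDecider X (ω.tangle ∩ sepsBelow G k)) :
    IsClosed (ω.tangle ∩ sepsBelow G k) := by
  rw [← isOpen_compl_iff]
  refine isOpen_of_forall_agree fun p hp => ?_
  by_cases hk : p.1.order < k
  · have hτ : p ∉ ω.tangle := fun h => hp ⟨h, hk⟩
    refine ⟨X, hX, fun s hs hsτ => ?_⟩
    have hA : s.1.A ∩ X = p.1.A ∩ X := by
      ext z
      exact and_congr_left fun hz => (hs z hz).1
    have hB : s.1.B ∩ X = p.1.B ∩ X := by
      ext z
      exact and_congr_left fun hz => (hs z hz).2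
    have h₁ := hdec s hsτ
    rw [hA, hB] at h₁
    exact lt_asymm h₁ (hdec p.swap ⟨GraphEnd.swap_mem_tangle hτ, by
      rw [sepsBelow, Set.mem_ofPred_eq, FinSep.swap, Separation.swap_order]; exact hk⟩)
  -- Agreement with `p` on its own separator already forces order at least `k`.
  · refine ⟨p.1.A ∩ p.1.B, p.2, fun s hs hsτ => hk (lt_of_le_of_lt ?_ hsτ.2)⟩
    exact Set.encard_le_encard fun z hz => ⟨(hs z hz).1.2 hz.1, (hs z hz).2.2 hz.2⟩

/-! ### Linkings between finite sets -/

/-- If fewer than `n` vertices never separate `A` from `B` inside `U`, the same holds inside some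
finite subset of `U`. -/
theorem exists_finset_joined_avoiding (A B : Finset V) {U : Set V} (hA : ↑A ⊆ U) (hB : ↑B ⊆ U)
    (n : ℕ) (h : ∀ S : Finset V, ↑S ⊆ U → S.card < n →
      ∃ a ∈ A, ∃ b ∈ B, a ∉ S ∧ Joined G (U \ ↑S) a b) :
    ∃ W : Finset V, A ⊆ W ∧ B ⊆ W ∧ ↑W ⊆ U ∧ ∀ S : Finset V, S.card < n →
      ∃ a ∈ A, ∃ b ∈ B, a ∉ S ∧ Joined G (↑W \ ↑S) a b := by
  classical
  induction n with
  | zero => exact ⟨A ∪ B, Finset.subset_union_left, Finset.subset_union_right, by simp [hA, hB],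
      fun S hS => absurd hS (Nat.not_lt_zero _)⟩
  | succ n ih =>
    obtain ⟨W₀, hAW, hBW, hWU, hW⟩ := ih fun S hS hn => h S hS (by omega)
    have hch : ∀ S : Finset V, ∃ T : Finset V, ↑T ⊆ U ∧ (S ∈ W₀.powersetCard n →
        ∃ a ∈ A, ∃ b ∈ B, a ∉ S ∧ Joined G (↑T \ ↑S) a b) := by
      intro S
      by_cases hS : S ∈ W₀.powersetCard n
      · rw [Finset.mem_powersetCard] at hS
        have hSW : (S : Set V) ⊆ W₀ := by exact_mod_cast hS.1
        obtain ⟨a, ha, b, hb, haS, hj⟩ := h S (hSW.trans hWU) (by omega)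
        obtain ⟨T, hTU, -, -, hT⟩ := hj.exists_finset ⟨hA ha, haS⟩
        exact ⟨T, fun x hx => (hTU hx).1, fun _ => ⟨a, ha, b, hb, haS,
          hT.mono (by intro x hx; exact ⟨hx, (hTU hx).2⟩)⟩⟩
      · exact ⟨∅, by simp, fun h => absurd h hS⟩
    choose T hTU hT using hch
    refine ⟨W₀ ∪ (W₀.powersetCard n).biUnion T, hAW.trans Finset.subset_union_left,
      hBW.trans Finset.subset_union_left, ?_, fun S hS => ?_⟩
    · intro x hx
      rcases Finset.mem_union.1 (Finset.mem_coe.1 hx) with hx | hx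
      · exact hWU hx
      · obtain ⟨S, -, hS⟩ := Finset.mem_biUnion.1 hx
        exact hTU S hS
    -- If `S` has fewer than `n` vertices in `W₀`, then `W₀` suffices. Otherwise `S` is one of
    -- finitely many `n`-subsets of `W₀`, and each had a finite walk added for it.
    · by_cases hSn : (S ∩ W₀).card < n
      · obtain ⟨a, ha, b, hb, haS, hj⟩ := hW _ hSn
        refine ⟨a, ha, b, hb, fun h => haS (Finset.mem_inter.2 ⟨h, hAW ha⟩), hj.mono ?_⟩
        rintro x ⟨hx, hxS⟩
        exact ⟨Finset.mem_union_left _ hx, fun h => hxS (Finset.mem_inter.2 ⟨h, hx⟩)⟩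
      · have hSW : S ∩ W₀ = S := Finset.eq_of_subset_of_card_le Finset.inter_subset_left (by omega)
        have hmem : S ∈ W₀.powersetCard n := by
          rw [hSW] at hSn
          exact Finset.mem_powersetCard.2 ⟨Finset.inter_eq_left.1 hSW, by omega⟩
        obtain ⟨a, ha, b, hb, haS, hj⟩ := hT S hmem
        refine ⟨a, ha, b, hb, haS, hj.mono ?_⟩
        rintro x ⟨hx, hxS⟩
        refine ⟨?_, hxS⟩
        exact Finset.mem_union_right _ (Finset.mem_biUnion.2 ⟨S, hmem, hx⟩)

/-- A form of Menger's theorem: `A` is linked to `B` inside `W` by disjoint paths, encoded by the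
injective map that takes each of their vertices to the next one. -/
theorem exists_injOn_step {W A B : Finset V}
    (h : ∀ S : Finset V, S.card < A.card → ∃ a ∈ A, ∃ b ∈ B, a ∉ S ∧ Joined G (↑W \ ↑S) a b) :
    ∃ f : V → V, Set.InjOn f (↑W \ ↑B) ∧
      ∀ x ∈ W, x ∉ B → f x ∈ W ∧ f x ∉ A ∧ (f x = x ∨ G.Adj x (f x)) := by
  classical
  let t : ↥(W \ B) → Finset V := fun x => (W \ A).filter fun y => y = x ∨ G.Adj x y
  -- Hall's condition: if `T` had a candidate set `N` smaller than itself, `(N ∪ A) \ T` would have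
  -- fewer than `|A|` vertices. A walk from `A` avoiding it starts in `T` and cannot leave `T`, yet
  -- `T` misses `B`.
  have hall : ∀ s : Finset ↥(W \ B), s.card ≤ (s.biUnion t).card := by
    intro s
    by_contra! hlt
    set T : Finset V := s.map (Function.Embedding.subtype _) with hT
    have hTW : ∀ x ∈ T, x ∈ W ∧ x ∉ B := by
      intro x hx
      obtain ⟨y, -, rfl⟩ := Finset.mem_map.1 hx
      exact Finset.mem_sdiff.1 y.2
    have hmem : ∀ x ∈ T, ∀ y ∈ W, y ∉ A → (y = x ∨ G.Adj x y) → y ∈ s.biUnion t := by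
      intro x hx y hy hyA hxy
      obtain ⟨z, hz, rfl⟩ := Finset.mem_map.1 hx
      exact Finset.mem_biUnion.2 ⟨z, hz, Finset.mem_filter.2 ⟨Finset.mem_sdiff.2 ⟨hy, hyA⟩, hxy⟩⟩
    have hTsub : T ⊆ s.biUnion t ∪ A := by
      intro x hx
      by_cases hxA : x ∈ A
      · exact Finset.mem_union_right _ hxA
      · exact Finset.mem_union_left _ (hmem x hx x (hTW x hx).1 hxA (Or.inl rfl))
    have hcard : ((s.biUnion t ∪ A) \ T).card < A.card := by
      have h1 := Finset.card_sdiff_add_card_eq_card hTsub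
      have h2 := Finset.card_union_le (s.biUnion t) A
      have h3 : T.card = s.card := Finset.card_map _
      omega
    obtain ⟨a, ha, b, hb, haS, hj⟩ := h _ hcard
    have haT : a ∈ T := by
      by_contra haT
      exact haS (Finset.mem_sdiff.2 ⟨Finset.mem_union_right _ ha, haT⟩)
    have hbT : b ∈ (T : Set V) := by
      refine hj.induct haT fun u hu v _ hv huv => ?_
      by_contra hvT
      refine hv.2 (Finset.mem_sdiff.2 ⟨?_, hvT⟩)
      by_cases hvA : v ∈ A
      · exact Finset.mem_union_right _ hvA
      · exact Finset.mem_union_left _ (hmem u hu v hv.1 hvA (Or.inr huv))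
    exact (hTW b hbT).2 hb
  obtain ⟨f, hf, hft⟩ := (Finset.all_card_le_biUnion_card_iff_exists_injective t).1 hall
  refine ⟨fun x => if hx : x ∈ W \ B then f ⟨x, hx⟩ else x, ?_, fun x hx hxB => ?_⟩
  · intro x hx y hy hxy
    have hx' : x ∈ W \ B := Finset.mem_sdiff.2 hx
    have hy' : y ∈ W \ B := Finset.mem_sdiff.2 hy
    simp only [hx', hy', dif_pos] at hxy
    exact congrArg Subtype.val (hf hxy)
  · have hx' : x ∈ W \ B := Finset.mem_sdiff.2 ⟨hx, hxB⟩
    simp only [hx', dif_pos]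
    have := hft ⟨x, hx'⟩
    rw [Finset.mem_filter, Finset.mem_sdiff] at this
    exact ⟨this.1.1, this.1.2, this.2⟩

/-- Cancel `f` on both sides until a starting point appears; it is not a value of `f`, so both
counts reach zero together. Orbits are thus injective, and disjoint for distinct starts. -/
theorem iterate_injOn {α : Type*} {f : α → α} {U : Set α} (hmaps : Set.MapsTo f U U)
    (hinj : Set.InjOn f U) {a b : α} (ha : a ∈ U) (hb : b ∈ U) (ha' : ∀ u ∈ U, f u ≠ a)
    (hb' : ∀ u ∈ U, f u ≠ b) {i j : ℕ} (h : f^[i] a = f^[j] b) : i = j ∧ a = b := by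
  induction i generalizing j with
  | zero =>
    cases j with
    | zero => exact ⟨rfl, h⟩
    | succ j =>
      rw [Function.iterate_succ_apply'] at h
      exact absurd h.symm (ha' _ (hmaps.iterate j hb))
  | succ i ih =>
    cases j with
    | zero =>
      rw [Function.iterate_succ_apply'] at h
      exact absurd h (hb' _ (hmaps.iterate i ha))
    | succ j =>
      rw [Function.iterate_succ_apply', Function.iterate_succ_apply'] at h
      obtain ⟨hij, hab⟩ := ih (hinj (hmaps.iterate i ha) (hmaps.iterate j hb) h)
      exact ⟨congrArg _ hij, hab⟩

/-! ### Tight separations in an end tangle -/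

/-- The partial order of separations: `(A, B) ≤ (A', B')` if `A ⊆ A'` and `B' ⊆ B`. -/
def FinSep.IsLE (s t : FinSep G) : Prop := s.1.A ⊆ t.1.A ∧ t.1.B ⊆ s.1.B

theorem FinSep.IsLE.trans {s t u : FinSep G} (h : s.IsLE t) (h' : t.IsLE u) : s.IsLE u :=
  ⟨h.1.trans h'.1, h'.2.trans h.2⟩

/-- The supremum `(A ∪ A', B ∩ B')` of two separations. -/
def FinSep.sup (s t : FinSep G) : FinSep G :=
  ⟨{ A := s.1.A ∪ t.1.A
     B := s.1.B ∩ t.1.B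
     union_eq := by
      ext x
      have h := s.1.mem_or x
      have h' := t.1.mem_or x
      simp only [Set.mem_union, Set.mem_inter_iff, Set.mem_univ, iff_true]
      tauto
     not_adj := by
      rintro a ⟨-, ha⟩ b ⟨-, hb⟩ hab
      by_cases h : a ∈ s.1.B
      · exact hb (Or.inr (t.1.mem_A_of_adj (fun h' => ha ⟨h, h'⟩) hab))
      · exact hb (Or.inl (s.1.mem_A_of_adj h hab)) },
    (s.2.union t.2).subset (by
      rintro x ⟨h | h, h₁, h₂⟩
      · exact Or.inl ⟨h, h₁⟩
      · exact Or.inr ⟨h, h₂⟩)⟩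

theorem GraphEnd.sup_mem_tangle {ω : GraphEnd G} {s t : FinSep G} (hs : s ∈ ω.tangle)
    (ht : t ∈ ω.tangle) : s.sup t ∈ ω.tangle :=
  fun R hR => (hs R hR).inter (ht R hR)

/-- The separation `(A, V)` for finite `A`. -/
def FinSep.ofFinite (G : SimpleGraph V) {A : Set V} (hA : A.Finite) : FinSep G :=
  ⟨{ A := A
     B := Set.univ
     union_eq := Set.union_univ A
     not_adj := fun _ ha => absurd (Set.mem_univ _) ha.2 }, hA.subset Set.inter_subset_left⟩

theorem GraphEnd.ofFinite_mem_tangle (ω : GraphEnd G) {A : Set V} (hA : A.Finite) :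
    FinSep.ofFinite G hA ∈ ω.tangle :=
  fun _ _ => ⟨0, fun _ _ => Set.mem_univ _⟩

/-- Any finite set can be separated from `ω`, except for its dominating vertices. -/
theorem GraphEnd.exists_mem_tangle_separating (ω : GraphEnd G) {Z : Set V} (hZ : Z.Finite) :
    ∃ s ∈ ω.tangle, Z ⊆ s.1.A ∧ ∀ z ∈ Z, z ∈ s.1.B → ω.IsDominatedBy z := by
  induction Z, hZ using Set.Finite.induction_on with
  | empty => exact ⟨_, ω.ofFinite_mem_tangle Set.finite_empty, by simp, by simp⟩
  | @insert z Z _ _ ih =>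
    obtain ⟨s, hs, hZA, hZB⟩ := ih
    obtain ⟨t, ht, hzA, hzB⟩ : ∃ t ∈ ω.tangle, z ∈ t.1.A ∧ (z ∈ t.1.B → ω.IsDominatedBy z) := by
      by_cases hz : ω.IsDominatedBy z
      · exact ⟨_, ω.ofFinite_mem_tangle (Set.finite_singleton z), rfl, fun _ => hz⟩
      · obtain ⟨t, ht, hzt⟩ := GraphEnd.exists_mem_tangle_of_not_isDominatedBy hz
        exact ⟨t, ht, (t.1.mem_or z).resolve_right hzt, fun h => absurd h hzt⟩
    refine ⟨s.sup t, GraphEnd.sup_mem_tangle hs ht, ?_, ?_⟩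
    · rintro x (rfl | hx)
      · exact Or.inr hzA
      · exact Or.inl (hZA hx)
    · rintro x (rfl | hx) hxB
      · exact hzB hxB.2
      · exact hZB x hx hxB.1

/-- No separation in the tangle of `ω` beyond `s` has smaller order than `s`. -/
def FinSep.IsTight (ω : GraphEnd G) (s : FinSep G) : Prop :=
  ∀ t ∈ ω.tangle, s.IsLE t → (s.1.A ∩ s.1.B).ncard ≤ (t.1.A ∩ t.1.B).ncard

/-- Everything outside the component of `G - (A ∩ B)` containing tails of the `ω`-rays moves to the
`A`-side; the separator is unchanged. -/
theorem GraphEnd.exists_isLE_joined {ω : GraphEnd G} {s : FinSep G} (hs : s ∈ ω.tangle) :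
    ∃ t ∈ ω.tangle, s.IsLE t ∧ t.1.A ∩ t.1.B = s.1.A ∩ s.1.B ∧
      ∀ x ∈ t.1.B \ t.1.A, ∀ y ∈ t.1.B \ t.1.A, Joined G (t.1.B \ t.1.A) x y := by
  obtain ⟨M, hMS, hω, hM, hclosed⟩ := ω.exists_component s.2
  obtain ⟨R, hR⟩ := ω.exists_ray
  obtain ⟨n, hn⟩ := (hω R hR).inter (GraphEnd.tails_of_mem_tangle hs R hR)
  obtain ⟨hnM, -, hnA⟩ := hn n le_rfl
  have hMA : ∀ x ∈ M, x ∉ s.1.A := fun x hx => s.1.swap.notMem_B_of_joined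
    (fun u hu hB hA => Set.disjoint_left.1 hMS hu ⟨hA, hB⟩) (hM _ hnM _ hx) hnA
  let t : Separation G :=
    { A := Mᶜ
      B := M ∪ (s.1.A ∩ s.1.B)
      union_eq := by ext x; by_cases hx : x ∈ M <;> simp [hx]
      not_adj := by
        rintro a ⟨ha, ha'⟩ b ⟨-, hb⟩ hab
        exact ha (hclosed b (not_not.1 hb) a hab.symm fun h => ha' (Or.inr h)) }
  have hinter : t.A ∩ t.B = s.1.A ∩ s.1.B := by
    ext x
    constructor
    · rintro ⟨hx, hx' | hx'⟩
      · exact absurd hx' hx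
      · exact hx'
    · exact fun hx => ⟨fun h => Set.disjoint_left.1 hMS h hx, Or.inr hx⟩
  have hdiff : t.B \ t.A = M := by
    ext x
    exact ⟨fun hx => not_not.1 hx.2, fun hx => ⟨Or.inl hx, not_not.2 hx⟩⟩
  refine ⟨⟨t, hinter ▸ s.2⟩, fun R hR => (hω R hR).mono Set.subset_union_left,
    ⟨fun x hx h => hMA x h hx, ?_⟩, hinter, ?_⟩
  · rintro x (hx | hx)
    · exact (s.1.mem_or x).resolve_left (hMA x hx)
    · exact hx.2
  · change ∀ x ∈ t.B \ t.A, ∀ y ∈ t.B \ t.A, Joined G (t.B \ t.A) x y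
    rw [hdiff]
    exact hM

/-- Minimal order among separations with `p` gives tightness, since `p` passes to everything beyond.
Making `B \ A` connected keeps the separator and so the minimality. -/
theorem GraphEnd.exists_isTight {ω : GraphEnd G} {p : FinSep G → Prop}
    (hp : ∀ s t, p s → s.IsLE t → p t) (h : ∃ s ∈ ω.tangle, p s) :
    ∃ s ∈ ω.tangle, p s ∧ s.IsTight ω ∧
      ∀ x ∈ s.1.B \ s.1.A, ∀ y ∈ s.1.B \ s.1.A, Joined G (s.1.B \ s.1.A) x y := by
  obtain ⟨s, ⟨hs, hps⟩, hmin⟩ := (measure fun s : FinSep G => (s.1.A ∩ s.1.B).ncard).wf.has_min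
    {s | s ∈ ω.tangle ∧ p s} h
  obtain ⟨t, ht, hst, hinter, hj⟩ := GraphEnd.exists_isLE_joined hs
  refine ⟨t, ht, hp s t hps hst, fun u hu htu => ?_, hj⟩
  rw [hinter]
  exact not_lt.1 (hmin u ⟨hu, hp s u hps (hst.trans htu)⟩)

/-- The vertices of `A ∩ B` outside `D`. -/
noncomputable def FinSep.core (D : Set V) (s : FinSep G) : Finset V :=
  (s.2.subset (Set.sdiff_subset : (s.1.A ∩ s.1.B) \ D ⊆ _)).toFinset

theorem FinSep.mem_core {D : Set V} {s : FinSep G} {v : V} :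
    v ∈ s.core D ↔ (v ∈ s.1.A ∧ v ∈ s.1.B) ∧ v ∉ D :=
  Set.Finite.mem_toFinset _

theorem FinSep.ncard_eq_core {D : Set V} {s : FinSep G} (hD : D ⊆ s.1.A ∩ s.1.B) :
    (s.1.A ∩ s.1.B).ncard = (s.core D).card + D.ncard := by
  rw [FinSep.core, ← Set.ncard_eq_toFinset_card _ (s.2.subset Set.sdiff_subset),
    Set.ncard_sdiff_add_ncard_of_subset hD s.2]

/-- A tight separation is linked to each separation beyond it. -/
theorem FinSep.IsTight.exists_injOn_step {ω : GraphEnd G} {s t : FinSep G} (hs : s.IsTight ω)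
    (ht : t ∈ ω.tangle) (hst : s.IsLE t) {D : Set V} (hDs : D ⊆ s.1.A ∩ s.1.B) :
    ∃ W : Finset V, s.core D ⊆ W ∧ t.core D ⊆ W ∧ ↑W ⊆ (s.1.B ∩ t.1.A) \ D ∧
      ∃ f : V → V, Set.InjOn f (↑W \ ↑(t.core D)) ∧ ∀ x ∈ W, x ∉ t.core D →
        f x ∈ W ∧ f x ∉ s.core D ∧ (f x = x ∨ G.Adj x (f x)) := by
  classical
  obtain ⟨W, hsW, htW, hWU, hW⟩ := exists_finset_joined_avoiding (G := G) (s.core D) (t.core D)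
    (U := (s.1.B ∩ t.1.A) \ D)
    (fun v hv => by
      obtain ⟨⟨hA, hB⟩, hD⟩ := FinSep.mem_core.1 hv
      exact ⟨⟨hB, hst.1 hA⟩, hD⟩)
    (fun v hv => by
      obtain ⟨⟨hA, hB⟩, hD⟩ := FinSep.mem_core.1 hv
      exact ⟨⟨hst.2 hB, hA⟩, hD⟩) (s.core D).card (by
      intro S hSU hcard
      by_contra! hno
      set U : Set V := (s.1.B ∩ t.1.A) \ D with hU
      -- `K` is what the core of `s` reaches while avoiding `S`. Moving `K ∪ S` to the `A`-side
      -- gives a tangle separation beyond `s` with separator inside `S ∪ D`, contradicting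
      -- tightness.
      set K : Set V := {x | ∃ a ∈ s.core D, a ∉ S ∧ Joined G (U \ ↑S) a x} with hK
      have hKU : ∀ x ∈ K, x ∈ U \ ↑S := by
        rintro x ⟨a, ha, haS, hj⟩
        obtain ⟨⟨hA, hB⟩, hD⟩ := FinSep.mem_core.1 ha
        exact hj.mem ⟨⟨⟨hB, hst.1 hA⟩, hD⟩, haS⟩
      have hKt : ∀ x ∈ K, x ∉ t.core D := fun x ⟨a, ha, haS, hj⟩ hx => hno a ha x hx haS hj
      let u : Separation G :=
        { A := s.1.A ∪ K ∪ ↑S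
          B := s.1.B \ K
          union_eq := by
            ext x
            have := s.1.mem_or x
            by_cases hx : x ∈ K
            · simp [hx]
            · simp only [Set.mem_union, hx, or_false, Set.mem_sdiff, not_false_eq_true, and_true,
                Set.mem_univ, iff_true]
              tauto
          not_adj := by
            rintro a ⟨-, ha⟩ b ⟨⟨hbB, hbK⟩, hb⟩ hab
            have hbA : b ∉ s.1.A := fun h => hb (Or.inl (Or.inl h))
            by_cases haK : a ∈ K
            · obtain ⟨c, hc, hcS, hj⟩ := haK
              have haU := hKU a ⟨c, hc, hcS, hj⟩
              by_cases hbt : b ∈ t.1.A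
              · exact hbK ⟨c, hc, hcS, hj.tail ⟨haU, ⟨⟨⟨hbB, hbt⟩, fun h => hbA (hDs h).1⟩,
                  fun h => hb (Or.inr h)⟩, hab⟩⟩
              · exact hKt a ⟨c, hc, hcS, hj⟩ (FinSep.mem_core.2
                  ⟨⟨haU.1.1.2, t.1.swap.mem_A_of_adj hbt hab.symm⟩, haU.1.2⟩)
            · exact hbA (s.1.mem_A_of_adj (fun h => ha ⟨h, haK⟩) hab) }
      have hsub : u.A ∩ u.B ⊆ ↑S ∪ D := by
        rintro x ⟨(hx | hx) | hx, hxB, hxK⟩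
        · by_contra hxSD
          rw [Set.mem_union, not_or] at hxSD
          exact hxK ⟨x, FinSep.mem_core.2 ⟨⟨hx, hxB⟩, hxSD.2⟩, hxSD.1, Relation.ReflTransGen.refl⟩
        · exact absurd hx hxK
        · exact Or.inl hx
      have hfin : (↑S ∪ D : Set V).Finite := S.finite_toSet.union (s.2.subset hDs)
      have hu : (⟨u, hfin.subset hsub⟩ : FinSep G) ∈ ω.tangle := fun R hR =>
        (GraphEnd.tails_of_mem_tangle ht R hR).mono fun x hx =>
          ⟨hst.2 hx.1, fun h => hx.2 (hKU x h).1.1.2⟩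
      have h1 := hs _ hu ⟨fun x hx => Or.inl (Or.inl hx), fun x hx => hx.1⟩
      have h2 : (u.A ∩ u.B).ncard ≤ S.card + D.ncard :=
        (Set.ncard_le_ncard hsub hfin).trans
          ((Set.ncard_union_le _ _).trans (by rw [Set.ncard_coe_finset]))
      rw [FinSep.ncard_eq_core hDs] at h1
      have h3 : (s.core D).card + D.ncard ≤ S.card + D.ncard := h1.trans h2
      omega)
  exact ⟨W, hsW, htW, hWU, EndTangle.exists_injOn_step hW⟩

/-! ### Disjoint rays from a sequence of tight separations -/

/-- The vertices in all sides `B` of a sequence of strictly nested separations lie in `D`. -/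
theorem exists_notMem_B {D : Set V} {s : ℕ → FinSep G} (hle : ∀ i j, i ≤ j → (s i).IsLE (s j))
    (hDs : ∀ i, D ⊆ (s i).1.A ∩ (s i).1.B)
    (hcore : ∀ i j, i < j → ∀ v ∈ (s i).core D, v ∉ (s j).1.B)
    (hne : ∀ i, ((s i).core D).Nonempty)
    (hconn : ∀ x ∈ (s 0).1.B \ (s 0).1.A, ∀ y ∈ (s 0).1.B \ (s 0).1.A,
      Joined G ((s 0).1.B \ (s 0).1.A) x y) {x : V} (hx : x ∉ D) : ∃ i, x ∉ (s i).1.B := by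
  by_contra! hxB
  have hxA : ∀ i, x ∉ (s i).1.A := fun i h =>
    hcore i (i + 1) (by omega) x (FinSep.mem_core.2 ⟨⟨h, hxB i⟩, hx⟩) (hxB _)
  -- From index 1 on, `y` lies in every `A` but `x` in none, so one finite walk between them meets
  -- the cores of all later separations. These cores are pairwise disjoint, hence too many.
  obtain ⟨y, hy⟩ := hne 1
  have hy' := FinSep.mem_core.1 hy
  have hy0 : y ∈ (s 0).1.B := (hle 0 1 (by omega)).2 hy'.1.2
  have hyA : y ∉ (s 0).1.A := fun h =>
    hcore 0 1 (by omega) y (FinSep.mem_core.2 ⟨⟨h, hy0⟩, hy'.2⟩) hy'.1.2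
  obtain ⟨W, hW, -, -, hj⟩ := (hconn x ⟨hxB 0, hxA 0⟩ y ⟨hy0, hyA⟩).exists_finset ⟨hxB 0, hxA 0⟩
  have hmeet : ∀ i, ∃ w ∈ W, w ∈ (s (i + 2)).core D := by
    intro i
    by_contra! hno
    have hyi := (s (i + 2)).1.swap.notMem_B_of_joined (U := ↑W) (fun w hw hB hA =>
      hno w hw (FinSep.mem_core.2 ⟨⟨hA, hB⟩, fun h => (hW hw).2 (hDs 0 h).1⟩)) hj (hxA _)
    exact hyi ((hle 1 _ (by omega)).1 hy'.1.1)
  choose w hwW hw using hmeet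
  have hlt : ∀ i j, i < j → w i ≠ w j := fun i j hij h =>
    hcore (i + 2) (j + 2) (by omega) _ (hw i) (h ▸ (FinSep.mem_core.1 (hw j)).1.2)
  have hinj : Function.Injective w := by
    intro i j h
    by_contra hne
    rcases lt_or_gt_of_ne hne with h' | h'
    · exact hlt i j h' h
    · exact hlt j i h' h.symm
  exact Set.infinite_range_of_injective hinj (W.finite_toSet.subset (by
    rintro _ ⟨i, rfl⟩
    exact hwW i))

/-- The successor maps of consecutive linkings glue to one injective map `F`, because the sets `W i`
overlap only in cores; the rays are the `F`-orbits of the first core. -/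
theorem GraphEnd.exists_disjoint_rays {ω : GraphEnd G} {D : Set V} {s : ℕ → FinSep G}
    (hs : ∀ i, s i ∈ ω.tangle) (hle : ∀ i j, i ≤ j → (s i).IsLE (s j))
    (hDs : ∀ i, D ⊆ (s i).1.A ∩ (s i).1.B)
    (hcore : ∀ i j, i < j → ∀ v ∈ (s i).core D, v ∉ (s j).1.B)
    (hne : ∀ i, ((s i).core D).Nonempty) (htight : ∀ i, (s i).IsTight ω)
    (hconn : ∀ i, ∀ x ∈ (s i).1.B \ (s i).1.A, ∀ y ∈ (s i).1.B \ (s i).1.A,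
      Joined G ((s i).1.B \ (s i).1.A) x y) :
    ∃ ρ : ↥((s 0).core D) → Ray G, (∀ a, ρ a ∈ ω.rays) ∧
      ∀ a b, a ≠ b → Disjoint (ρ a).verts (ρ b).verts := by
  classical
  choose W hsW htW hWU f hinj hf using fun i =>
    (htight i).exists_injOn_step (hs (i + 1)) (hle i (i + 1) (by omega)) (hDs i)
  have hWcore : ∀ i j, i < j → ∀ x ∈ W i, x ∈ W j → x ∈ (s (i + 1)).core D ∧ x ∈ (s j).core D := by
    intro i j hij x hxi hxj
    have hA := (hWU i hxi).1.2
    have hB := (hWU j hxj).1.1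
    have hD := (hWU i hxi).2
    exact ⟨FinSep.mem_core.2 ⟨⟨hA, (hle (i + 1) j (by omega)).2 hB⟩, hD⟩,
      FinSep.mem_core.2 ⟨⟨(hle (i + 1) j (by omega)).1 hA, hB⟩, hD⟩⟩
  let L : ℕ → Set V := fun i => {x | x ∈ W i ∧ x ∉ (s (i + 1)).core D}
  have hL : ∀ i j x, x ∈ L i → x ∈ L j → i = j := by
    intro i j x hi hj
    rcases lt_trichotomy i j with h | h | h
    · exact absurd (hWcore i j h x hi.1 hj.1).1 hi.2
    · exact h
    · exact absurd (hWcore j i h x hj.1 hi.1).1 hj.2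
  let U : Set V := {x | ∃ i, x ∈ L i}
  let F : V → V := fun x => if h : ∃ i, x ∈ L i then f h.choose x else x
  have hF : ∀ i x, x ∈ L i → F x = f i x := by
    intro i x hx
    have h : ∃ i, x ∈ L i := ⟨i, hx⟩
    simp only [F, dif_pos h]
    rw [hL _ i x h.choose_spec hx]
  have hmaps : Set.MapsTo F U U := by
    rintro x ⟨i, hx⟩
    rw [hF i x hx]
    obtain ⟨hW', -, -⟩ := hf i x hx.1 hx.2
    by_cases hc : f i x ∈ (s (i + 1)).core D
    · refine ⟨i + 1, hsW _ hc, fun h => ?_⟩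
      exact hcore (i + 1) (i + 2) (by omega) _ hc (FinSep.mem_core.1 h).1.2
    · exact ⟨i, hW', hc⟩
  have hFinj : Set.InjOn F U := by
    rintro x ⟨i, hx⟩ y ⟨j, hy⟩ hxy
    rw [hF i x hx, hF j y hy] at hxy
    obtain ⟨hi, hi', -⟩ := hf i x hx.1 hx.2
    obtain ⟨hj, hj', -⟩ := hf j y hy.1 hy.2
    -- A common value from two layers would lie in the core of the later index, which the later map
    -- never hits.
    rcases lt_trichotomy i j with h | rfl | h
    · exact absurd (hWcore i j h _ (hxy ▸ hi) hj).2 hj'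
    · exact hinj i hx hy hxy
    · exact absurd (hWcore j i h _ (hxy ▸ hj) hi).2 hi'
  have hstart : ∀ a ∈ (s 0).core D, a ∈ U ∧ ∀ u ∈ U, F u ≠ a := by
    intro a ha
    have ha' := FinSep.mem_core.1 ha
    refine ⟨⟨0, hsW 0 ha, fun h => ?_⟩, ?_⟩
    · exact hcore 0 1 (by omega) a ha (FinSep.mem_core.1 h).1.2
    · rintro u ⟨i, hu⟩ rfl
      rw [hF i u hu] at ha ha'
      obtain ⟨hi, hi', -⟩ := hf i u hu.1 hu.2
      exact hi' (FinSep.mem_core.2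
        ⟨⟨(hle 0 i (by omega)).1 ha'.1.1, (hWU i hi).1.1⟩, ha'.2⟩)
  have horbit : ∀ a ∈ (s 0).core D, ∀ b ∈ (s 0).core D, ∀ i j, F^[i] a = F^[j] b →
      i = j ∧ a = b := fun a ha b hb i j h =>
    iterate_injOn hmaps hFinj (hstart a ha).1 (hstart b hb).1 (hstart a ha).2 (hstart b hb).2 h
  let ρ : ↥((s 0).core D) → Ray G := fun a =>
    { vertex := fun i => F^[i] a
      injective := fun i j h => (horbit a a.2 a a.2 i j h).1
      adj := by
        intro i
        obtain ⟨j, hj⟩ := hmaps.iterate i (hstart a a.2).1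
        -- A stationary step would repeat a vertex of the injective orbit, so every step is an edge.
        rcases (hf j _ hj.1 hj.2).2.2 with h | h
        · have : F^[i + 1] a = F^[i] a := by
            rw [Function.iterate_succ_apply', hF j _ hj, h]
          have := (horbit a a.2 a a.2 _ _ this).1
          omega
        · rw [Function.iterate_succ_apply', hF j _ hj]
          exact h }
  refine ⟨ρ, fun a => ?_, fun a b hab => ?_⟩
  -- The orbit is injective and each `W j` is finite, so it eventually stays in layers beyond index
  -- `i`.
  · have htail : ∀ i, (ρ a).HasTailIn ((s i).1.B \ (s i).1.A) := by
      intro i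
      obtain ⟨n, hn⟩ := (ρ a).hasTailIn_compl
        (((Finset.range (i + 1)).biUnion W ∪ (s i).core D : Finset V).finite_toSet)
      refine ⟨n, fun m hm => ?_⟩
      have hnot := hn m hm
      rw [Set.mem_compl_iff, Finset.mem_coe, Finset.mem_union, not_or] at hnot
      obtain ⟨j, hj⟩ : (ρ a).vertex m ∈ U := hmaps.iterate m (hstart a a.2).1
      have hij : i < j := by
        by_contra h
        exact hnot.1 (Finset.mem_biUnion.2 ⟨j, Finset.mem_range.2 (by omega), hj.1⟩)
      have hB := (hle i j hij.le).2 (hWU j hj.1).1.1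
      exact ⟨hB, fun hA => hnot.2 (FinSep.mem_core.2 ⟨⟨hA, hB⟩, (hWU j hj.1).2⟩)⟩
    refine GraphEnd.mem_rays_of_joined fun S hS => ?_
    -- Vertices of `S ∩ D` lie in every `A`, so only those outside `D` have to be left behind by
    -- `B`.
    obtain ⟨i, hi⟩ : ∃ i, ∀ x ∈ S, x ∉ D → x ∉ (s i).1.B := by
      induction S, hS using Set.Finite.induction_on with
      | empty => exact ⟨0, by simp⟩
      | @insert x S _ _ ih =>
        obtain ⟨i, hi⟩ := ih
        by_cases hx : x ∈ D
        · refine ⟨i, ?_⟩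
          rintro y (rfl | hy) hyD
          · exact absurd hx hyD
          · exact hi y hy hyD
        · obtain ⟨j, hj⟩ := exists_notMem_B hle hDs hcore hne (hconn 0) hx
          refine ⟨max i j, ?_⟩
          rintro y (rfl | hy) hyD hyB
          · exact hj ((hle j _ (le_max_right i j)).2 hyB)
          · exact hi y hy hyD ((hle i _ (le_max_left i j)).2 hyB)
    refine ⟨(s i).1.B \ (s i).1.A, Set.disjoint_left.2 fun x hx hxS => ?_, htail i,
      GraphEnd.tails_of_mem_tangle (hs i), hconn i⟩
    exact hi x hxS (fun h => hx.2 (hDs i h).1) hx.1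
  · rw [Set.disjoint_left]
    rintro _ ⟨i, rfl⟩ ⟨j, hj⟩
    exact hab (Subtype.ext (horbit b b.2 a a.2 j i hj).2.symm)

/-- If `deg ω + dom ω < k`, then any finite set can be separated from `ω`, except for its dominating
vertices, by fewer than `k` vertices. -/
theorem GraphEnd.exists_mem_sepsBelow_separating (ω : GraphEnd G) {k : ℕ}
    (hk : ω.degree + ω.dom < k) {Z : Set V} (hZ : Z.Finite) :
    ∃ s ∈ ω.tangle ∩ sepsBelow G k, Z ⊆ s.1.A ∧ ∀ z ∈ Z, z ∈ s.1.B → ω.IsDominatedBy z := by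
  by_contra! hno
  set D : Set V := {v | ω.IsDominatedBy v} with hDdef
  have hD : D.Finite := by
    rw [← Set.encard_lt_top_iff]
    exact (le_add_self.trans_lt hk).trans (ENat.natCast_lt_top k)
  have hstep : ∀ s ∈ ω.tangle, ∃ t ∈ ω.tangle, (s.IsLE t ∧ ∀ v ∈ s.core D, v ∉ t.1.B) ∧
      t.IsTight ω ∧
      ∀ x ∈ t.1.B \ t.1.A, ∀ y ∈ t.1.B \ t.1.A, Joined G (t.1.B \ t.1.A) x y := by
    intro s hs
    refine GraphEnd.exists_isTight (fun t u ht htu => ⟨ht.1.trans htu, fun v hv h =>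
      ht.2 v hv (htu.2 h)⟩) ?_
    obtain ⟨u, hu, -, huB⟩ := ω.exists_mem_tangle_separating (s.core D).finite_toSet
    exact ⟨s.sup u, GraphEnd.sup_mem_tangle hs hu,
      ⟨Set.subset_union_left, Set.inter_subset_left⟩,
      fun v hv hvB => (FinSep.mem_core.1 hv).2 (huB v hv hvB.2)⟩
  -- Putting `D` into `A` at the start places it in every separator of the sequence.
  obtain ⟨s₀, hs₀, ⟨hZA, hZB⟩, htight₀, hconn₀⟩ := GraphEnd.exists_isTight (ω := ω)
    (p := fun s => Z ∪ D ⊆ s.1.A ∧ ∀ z ∈ Z ∪ D, z ∈ s.1.B → ω.IsDominatedBy z)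
    (fun s t hs hst => ⟨hs.1.trans hst.1, fun z hz hzB => hs.2 z hz (hst.2 hzB)⟩)
    (ω.exists_mem_tangle_separating (hZ.union hD))
  let Q := {t : FinSep G // t ∈ ω.tangle ∧ t.IsTight ω ∧
      ∀ x ∈ t.1.B \ t.1.A, ∀ y ∈ t.1.B \ t.1.A, Joined G (t.1.B \ t.1.A) x y}
  have hstep' : ∀ q : Q, ∃ r : Q, q.1.IsLE r.1 ∧ ∀ v ∈ q.1.core D, v ∉ r.1.1.B := by
    rintro ⟨q, hq, -⟩
    obtain ⟨t, ht, h, h'⟩ := hstep q hq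
    exact ⟨⟨t, ht, h'⟩, h⟩
  choose next hnext using hstep'
  let q : ℕ → Q := fun n => next^[n] ⟨s₀, hs₀, htight₀, hconn₀⟩
  have hq : ∀ n, q (n + 1) = next (q n) := fun n => Function.iterate_succ_apply' _ _ _
  have hle : ∀ i j, i ≤ j → (q i).1.IsLE (q j).1 := by
    intro i j hij
    induction j, hij using Nat.le_induction with
    | base => exact ⟨subset_rfl, subset_rfl⟩
    | succ j _ ih => exact ih.trans (hq j ▸ (hnext (q j)).1)
  have hDs : ∀ i, D ⊆ (q i).1.1.A ∩ (q i).1.1.B := fun i d hd =>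
    ⟨(hle 0 i (by omega)).1 (hZA (Or.inr hd)), GraphEnd.IsDominatedBy.mem_B hd (q i).2.1⟩
  have hcore : ∀ i j, i < j → ∀ v ∈ (q i).1.core D, v ∉ (q j).1.1.B := fun i j hij v hv h =>
    (hnext (q i)).2 v hv (hq i ▸ (hle (i + 1) j hij).2 h)
  have hcard : ∀ i, (k : ℕ∞) ≤ ((q i).1.core D).card + ω.dom := by
    intro i
    -- A member of order less than `k` would be a separation of the kind assumed not to exist.
    have hk' : (k : ℕ∞) ≤ (q i).1.1.order := by
      by_contra hlt
      obtain ⟨z, hz, hzB, hz'⟩ := hno (q i).1 ⟨(q i).2.1, not_le.1 hlt⟩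
        fun z hz => (hle 0 i (by omega)).1 (hZA (Or.inl hz))
      exact hz' (hZB z (Or.inl hz) ((hle 0 i (by omega)).2 hzB))
    have hdom : ω.dom = D.ncard := hD.cast_ncard_eq.symm
    rw [Separation.order, ← (q i).1.2.cast_ncard_eq, FinSep.ncard_eq_core (hDs i)] at hk'
    rw [hdom]
    exact_mod_cast hk'
  have hne : ∀ i, ((q i).1.core D).Nonempty := by
    intro i
    rw [Finset.nonempty_iff_ne_empty]
    intro h
    have := hcard i
    rw [h, Finset.card_empty, Nat.cast_zero, zero_add] at this
    exact absurd (this.trans le_add_self) (not_le.2 hk)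
  obtain ⟨ρ, hρ, hdis⟩ := GraphEnd.exists_disjoint_rays (fun i => (q i).2.1) hle hDs hcore hne
    (fun i => (q i).2.2.1) (fun i => (q i).2.2.2)
  have hρinj : Function.Injective ρ := by
    intro a b hab
    by_contra hne
    refine Set.disjoint_left.1 (hdis a b hne) ⟨0, rfl⟩ ?_
    rw [← hab]
    exact ⟨0, rfl⟩
  have hdeg : (((q 0).1.core D).card : ℕ∞) ≤ ω.degree := by
    have : (Set.range ρ).encard = ((q 0).1.core D).card := by
      rw [← Set.image_univ, hρinj.encard_image, Set.encard_univ, ENat.card_eq_coe_fintype_card,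
        Fintype.card_coe]
    rw [← this]
    refine le_iSup₂_of_le (Set.range ρ) ⟨?_, ?_⟩ le_rfl
    · rintro _ ⟨a, rfl⟩
      exact hρ a
    · rintro _ ⟨a, rfl⟩ _ ⟨b, rfl⟩ hab
      exact hdis a b fun h => hab (h ▸ rfl)
  exact absurd ((hcard 0).trans (by gcongr)) (not_le.2 hk)

/-- Otherwise `(V, D)`, with `D` the finite set of dominating vertices, is a limit of the closed set
without belonging to it: `ω`-rays leave `D`, while separations of order less than `k` in the tangle
agree with `(V, D)` on any given finite `Z`. -/
theorem GraphEnd.le_degree_add_dom_of_isClosed (ω : GraphEnd G) {k : ℕ}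
    (h : IsClosed (ω.tangle ∩ sepsBelow G k)) : (k : ℕ∞) ≤ ω.degree + ω.dom := by
  by_contra! hk
  have hD : {v | ω.IsDominatedBy v}.Finite := by
    rw [← Set.encard_lt_top_iff]
    exact (le_add_self.trans_lt hk).trans (ENat.natCast_lt_top k)
  have hlim : (FinSep.ofFinite G hD).swap ∈ (ω.tangle ∩ sepsBelow G k)ᶜ := by
    rintro ⟨hτ, -⟩
    obtain ⟨R, hR⟩ := ω.exists_ray
    exact Ray.not_hasTailIn_of_disjoint (R.hasTailIn_compl hD) disjoint_compl_left (hτ R hR)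
  obtain ⟨Z, hZ, hZO⟩ := exists_agree_of_isOpen h.isOpen_compl hlim
  obtain ⟨s, hs, hA, hB⟩ := ω.exists_mem_sepsBelow_separating hk hZ
  exact hZO s (fun z hz => ⟨iff_of_true (hA hz) (Set.mem_univ z), hB z hz,
    fun hd => GraphEnd.IsDominatedBy.mem_B hd hs.1⟩) hs

end EndTangle

theorem mainTheorem1 {V : Type*} (G : SimpleGraph V) (ω : EndTangle.GraphEnd G) (k : ℕ) :
    List.TFAE [
      IsClosed (ω.tangle ∩ EndTangle.sepsBelow G k),
      (k : ℕ∞) ≤ ω.degree + ω.dom,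
      ∃ X : Set V, X.Finite ∧
        EndTangle.IsRelativeDecider X (ω.tangle ∩ EndTangle.sepsBelow G k),
      ∃ X : Set V, X.encard = k ∧
        EndTangle.IsRelativeDecider X (ω.tangle ∩ EndTangle.sepsBelow G k)] := by
  tfae_have 1 → 2 := ω.le_degree_add_dom_of_isClosed
  tfae_have 2 → 4 := ω.exists_isRelativeDecider_of_le
  tfae_have 4 → 3 := fun ⟨X, hX, h⟩ => ⟨X, Set.finite_of_encard_eq_coe hX, h⟩
  tfae_have 3 → 1 := fun ⟨_, hX, h⟩ => ω.isClosed_of_isRelativeDecider hX h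
  tfae_finish
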